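/- Let $n\ge 1$ be an integer. Let $dV$ be Lebesgue measure on $\mathbb{C}^n$ normalized so that $\int_{\mathbb{C}^n} e^{-|z|^2}\,dV(z)=1$, and let $H(\mathbb{C}^n)$ be the space of entire functions on $\mathbb{C}^n$. For $\alpha\in\mathbb{R}$ and $f\in H(\mathbb{C}^n)$ put $$\|f\|_{F^p_\alpha}=\left\{\int_{\mathbb{C}^n}\bigl|f(z)e^{-\frac12|z|^2}\bigr|^p\frac{dV(z)}{(1+|z|)^\alpha}\right\}^{1/p}\quad(0<p<\infty),\qquad \|f\|_{F^\infty_\alpha}=\operatorname*{ess\,sup}_{z\in\mathbb{C}^n}\frac{|f(z)|e^{-\frac12|z|^2}}{(1+|z|)^\alpha},$$ and let $F^p_\alpha$ be the space of all $f\in H(\mathbb{C}^n)$ with $\|f\|_{F^p_\alpha}<\infty$. For $s\in\mathbb{R}$ and $f\in H(\mathbb{C}^n)$ with homogeneous expansion $f=\sum_{k\ge0}f_k$ ($f_k$ a homogeneous polynomial of degree $k$) define $$\mathcal{D}^sf=\sum_{k}\frac{\Gamma(n+s+k)}{\Gamma(n+k)}f_k,\qquad \mathcal{I}^sf=\sum_{k}\frac{\Gamma(n+k)}{\Gamma(n+s+k)}f_k,$$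 where both sums are over all $k\ge0$ if $s\ge0$ and over $k>|s|$ if $s<0$. **Theorem 3.13.** Let $s$ and $\alpha$ be real numbers. Then the operators $$\mathcal{D}^s,\ \mathcal{I}^{-s}:F^p_\alpha\to\begin{cases}F^p_{\alpha+2sp}&\text{if }0<p<\infty,\\ F^\infty_{\alpha+2s}&\text{if }p=\infty\end{cases}$$ are bounded; that is, they are linear maps between these spaces and, for each $p$, there is a finite constant $C$, independent of $f$, such that the norm of the image of $f$ in the target space is at most $C\|f\|_{F^p_\alpha}$ for all $f\in F^p_\alpha$. -/

import Mathlib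

open MeasureTheory
open scoped ENNReal NNReal

noncomputable section

namespace FockSobolev

/-- Complex `n`-space `ℂⁿ` with the norm `|z| = (∑ |z_j|²)^{1/2}`. -/
abbrev Cn (n : ℕ) : Type := EuclideanSpace ℂ (Fin n)

/-- The volume measure on `ℂⁿ`, normalized so that `∫ e^{-|z|²} dV(z) = 1`, i.e. Lebesgue measure
divided by `πⁿ`. -/
def dV (n : ℕ) : Measure (Cn n) :=
  ENNReal.ofReal ((Real.pi ^ n)⁻¹) •
    Measure.map (WithLp.toLp 2) (volume : Measure (Fin n → ℂ))

/-- The weighted measure `dV_α(z) = dV(z) / (1 + |z|)^α`. -/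
def dVw (n : ℕ) (α : ℝ) : Measure (Cn n) :=
  (dV n).withDensity fun z => ENNReal.ofReal (1 / (1 + ‖z‖) ^ α)

/-- The `L^p_α` norm with values in `[0, ∞]`: for `p < ∞` it is
`(∫ |ψ(z) e^{-|z|²/2}|^p dV_α(z))^{1/p}`, and for `p = ∞` it is
`esssup |ψ(z)| e^{-|z|²/2} / (1 + |z|)^α`. -/
def fockNorm (n : ℕ) (p : ℝ≥0∞) (α : ℝ) (ψ : Cn n → ℂ) : ℝ≥0∞ :=
  if p = ∞ then
    eLpNorm (fun z => ψ z * ((Real.exp (-‖z‖ ^ 2 / 2) / (1 + ‖z‖) ^ α : ℝ) : ℂ)) ∞ (dV n)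
  else
    eLpNorm (fun z => ψ z * ((Real.exp (-‖z‖ ^ 2 / 2) : ℝ) : ℂ)) p (dVw n α)

theorem fockNorm_add_lt_top {n : ℕ} {p : ℝ≥0∞} {α : ℝ} {f g : Cn n → ℂ}
    (hf : Continuous f) (hg : Continuous g)
    (hf' : fockNorm n p α f < ∞) (hg' : fockNorm n p α g < ∞) :
    fockNorm n p α (f + g) < ∞ := by
  have hpos : ∀ z : Cn n, (1 + ‖z‖ : ℝ) ≠ 0 := fun z => by positivity
  have hw : Continuous fun z : Cn n => (1 + ‖z‖) ^ α :=
    (continuous_const.add continuous_norm).rpow_const fun z => Or.inl (hpos z)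
  have hw' : ∀ z : Cn n, (1 + ‖z‖) ^ α ≠ 0 := fun z => by positivity
  unfold fockNorm at *
  split_ifs at * with hp
  · have key := eLpNorm_add_lt_top (μ := dV n) (p := ∞)
      ⟨(hf.mul (Complex.continuous_ofReal.comp ((Real.continuous_exp.comp
        (by fun_prop : Continuous fun z : Cn n => -‖z‖ ^ 2 / 2)).div hw hw'))).aestronglyMeasurable,
        hf'⟩
      ⟨(hg.mul (Complex.continuous_ofReal.comp ((Real.continuous_exp.comp
        (by fun_prop : Continuous fun z : Cn n => -‖z‖ ^ 2 / 2)).div hw hw'))).aestronglyMeasurable,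
        hg'⟩
    refine lt_of_eq_of_lt (congrArg (fun h => eLpNorm h ∞ (dV n)) ?_) key
    funext z
    simp [add_mul]
  · have key := eLpNorm_add_lt_top (μ := dVw n α) (p := p)
      ⟨(hf.mul (Complex.continuous_ofReal.comp (Real.continuous_exp.comp
        (by fun_prop : Continuous fun z : Cn n => -‖z‖ ^ 2 / 2)))).aestronglyMeasurable, hf'⟩
      ⟨(hg.mul (Complex.continuous_ofReal.comp (Real.continuous_exp.comp
        (by fun_prop : Continuous fun z : Cn n => -‖z‖ ^ 2 / 2)))).aestronglyMeasurable, hg'⟩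
    refine lt_of_eq_of_lt (congrArg (fun h => eLpNorm h p (dVw n α)) ?_) key
    funext z
    simp [add_mul]

theorem fockNorm_smul {n : ℕ} {p : ℝ≥0∞} {α : ℝ} (c : ℂ) (f : Cn n → ℂ) :
    fockNorm n p α (c • f) = ‖c‖ₑ * fockNorm n p α f := by
  unfold fockNorm
  split_ifs with hp
  · rw [← eLpNorm_const_smul]
    congr 1
    funext z
    simp [mul_assoc]
  · rw [← eLpNorm_const_smul]
    congr 1
    funext z
    simp [mul_assoc]

/-- The weighted Fock space `F^p_α`: the entire functions on `ℂⁿ` with finite `L^p_α` norm. -/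
def fock (n : ℕ) (p : ℝ≥0∞) (α : ℝ) : Submodule ℂ (Cn n → ℂ) where
  carrier := {f | Differentiable ℂ f ∧ fockNorm n p α f < ∞}
  zero_mem' := ⟨differentiable_const 0, by
    have h := fockNorm_smul (n := n) (p := p) (α := α) 0 0
    rw [zero_smul] at h
    rw [h]
    simp⟩
  add_mem' := fun hf hg =>
    ⟨hf.1.add hg.1, fockNorm_add_lt_top hf.1.continuous hg.1.continuous hf.2 hg.2⟩
  smul_mem' := fun c f hf =>
    ⟨hf.1.const_smul c, by
      rw [fockNorm_smul]
      exact ENNReal.mul_lt_top (by simp) hf.2⟩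

/-- The component `f_k` of degree `k` in the homogeneous expansion `f = ∑ f_k` of an entire
function: `f_k(z)` is the `k`-th Taylor coefficient at `0` of the function `λ ↦ f(λz)` of one
complex variable. See `hasSum_homogPart` and `homogPart_unique`. -/
def homogPart {n : ℕ} (k : ℕ) (f : Cn n → ℂ) (z : Cn n) : ℂ :=
  ((k.factorial : ℂ))⁻¹ * iteratedDeriv k (fun t : ℂ => f (t • z)) 0

/-- The components recover `f` along every complex line, and so (take `t = 1`) everywhere. -/
theorem hasSum_homogPart_line {n : ℕ} {f : Cn n → ℂ} (hf : Differentiable ℂ f) (z : Cn n) (t : ℂ) :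
    HasSum (fun k => homogPart k f z * t ^ k) (f (t • z)) := by
  have hd : Differentiable ℂ fun t : ℂ => f (t • z) := hf.comp (by fun_prop)
  have h := Complex.hasSum_taylorSeries_of_entire hd 0 t
  have e : (fun k => homogPart k f z * t ^ k) = fun k : ℕ => ((k.factorial : ℂ))⁻¹ •
      (t - 0) ^ k • iteratedDeriv k (fun t : ℂ => f (t • z)) 0 := by
    funext k
    simp only [homogPart, sub_zero, smul_eq_mul]
    ring
  rw [e]
  exact h

/-- `f = ∑ f_k`. -/
theorem hasSum_homogPart {n : ℕ} {f : Cn n → ℂ} (hf : Differentiable ℂ f) (z : Cn n) :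
    HasSum (fun k => homogPart k f z) (f z) := by
  simpa using hasSum_homogPart_line hf z 1

/-- If `f = ∑ P_k` with `P_k` a homogeneous polynomial of degree `k`, then `f_k = P_k`. -/
theorem homogPart_unique {n : ℕ} {f : Cn n → ℂ} (hf : Differentiable ℂ f)
    (P : ℕ → MvPolynomial (Fin n) ℂ) (hP : ∀ k, (P k).IsHomogeneous k)
    (h : ∀ z : Cn n, HasSum (fun k => MvPolynomial.eval z.ofLp (P k)) (f z)) (k : ℕ) (z : Cn n) :
    homogPart k f z = MvPolynomial.eval z.ofLp (P k) := by
  have key : ∀ a : ℕ → ℂ, (∀ t : ℂ, HasSum (fun k => a k * t ^ k) (f (t • z))) →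
      HasFPowerSeriesAt (fun t : ℂ => f (t • z)) (FormalMultilinearSeries.ofScalars ℂ a) 0 := by
    intro a ha
    rw [hasFPowerSeriesAt_iff]
    refine Filter.Eventually.of_forall fun t => ?_
    simpa [FormalMultilinearSeries.coeff_ofScalars, mul_comm] using ha t
  have h1 := key _ (hasSum_homogPart_line hf z)
  have h2 := key (fun k => MvPolynomial.eval z.ofLp (P k)) fun t => by
    convert h (t • z) using 2 with k
    rw [MvPolynomial.eval_eq, MvPolynomial.eval_eq, Finset.sum_mul]
    refine Finset.sum_congr rfl fun d hd => ?_
    have hdeg : ∑ i ∈ d.support, d i = k := by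
      have := hP k (MvPolynomial.mem_support_iff.mp hd)
      simpa [Finsupp.weight_apply, Finsupp.sum] using this
    simp only [PiLp.smul_apply, smul_eq_mul, mul_pow, Finset.prod_mul_distrib,
      Finset.prod_pow_eq_pow_sum, hdeg]
    ring
  have h3 := congrArg (fun p => p.coeff k) (h1.eq_formalMultilinearSeries h2)
  simpa [FormalMultilinearSeries.coeff_ofScalars] using h3

/-- The multiplier of the fractional derivative: `Γ(n+s+k)/Γ(n+k)`, over all `k ≥ 0` if `s ≥ 0` and
over `k > |s|` only if `s < 0`. -/
def derivCoeff (n : ℕ) (s : ℝ) (k : ℕ) : ℝ :=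
  if 0 ≤ s ∨ |s| < k then Real.Gamma (n + s + k) / Real.Gamma (n + k) else 0

/-- The multiplier of the fractional integral: `Γ(n+k)/Γ(n+s+k)`, over all `k ≥ 0` if `s ≥ 0` and
over `k > |s|` only if `s < 0`. -/
def integCoeff (n : ℕ) (s : ℝ) (k : ℕ) : ℝ :=
  if 0 ≤ s ∨ |s| < k then Real.Gamma (n + k) / Real.Gamma (n + s + k) else 0

/-- The fractional derivative `𝒟^s f` of order `s` (the series converges for entire `f`, see
`summable_fracDeriv`). -/
def fracDeriv {n : ℕ} (s : ℝ) (f : Cn n → ℂ) (z : Cn n) : ℂ :=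
  ∑' k : ℕ, (derivCoeff n s k : ℂ) * homogPart k f z

/-- The fractional integral `ℐ^s f` of order `s` (the series converges for entire `f`, see
`summable_fracInteg`). -/
def fracInteg {n : ℕ} (s : ℝ) (f : Cn n → ℂ) (z : Cn n) : ℂ :=
  ∑' k : ℕ, (integCoeff n s k : ℂ) * homogPart k f z

theorem summable_aux {n : ℕ} {f : Cn n → ℂ} (hf : Differentiable ℂ f) (z : Cn n) (c : ℕ → ℝ)
    (N : ℕ) (hc : ∀ k, N ≤ k → |c (k + 1)| ≤ 2 * |c k|) :
    Summable fun k => (c k : ℂ) * homogPart k f z := by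
  have hs := (hasSum_homogPart_line hf z 2).summable.norm
  have hb : ∀ k, N ≤ k → |c k| ≤ |c N| * 2 ^ (k - N) := by
    intro k hk
    induction k, hk using Nat.le_induction with
    | base => simp
    | succ k hk ih =>
      have := hc k hk
      rw [Nat.succ_sub hk, pow_succ]
      linarith
  refine Summable.of_norm_bounded_eventually_nat (hs.mul_left |c N|) ?_
  filter_upwards [Filter.eventually_ge_atTop N] with k hk
  have h1 : (2 : ℝ) ^ (k - N) ≤ 2 ^ k := pow_le_pow_right₀ (by norm_num) (by omega)
  have h2 : |c k| ≤ |c N| * 2 ^ k := (hb k hk).trans (by gcongr)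
  calc ‖(c k : ℂ) * homogPart k f z‖ = |c k| * ‖homogPart k f z‖ := by simp
    _ ≤ |c N| * 2 ^ k * ‖homogPart k f z‖ := by gcongr
    _ = |c N| * ‖homogPart k f z * 2 ^ k‖ := by simp; ring

/-- The series defining `𝒟^s f` converges absolutely. -/
theorem summable_fracDeriv {n : ℕ} (s : ℝ) {f : Cn n → ℂ} (hf : Differentiable ℂ f) (z : Cn n) :
    Summable fun k => (derivCoeff n s k : ℂ) * homogPart k f z := by
  obtain ⟨N, hN⟩ := exists_nat_gt (|s| + 1)
  refine summable_aux hf z _ N fun k hk => ?_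
  have hk' : (N : ℝ) ≤ k := by exact_mod_cast hk
  have hs := neg_abs_le s
  have hs' := le_abs_self s
  have hs0 := abs_nonneg s
  have hn : (0 : ℝ) ≤ n := Nat.cast_nonneg n
  have e1 : (n : ℝ) + s + ((k + 1 : ℕ) : ℝ) = (n + s + k) + 1 := by push_cast; ring
  have e2 : (n : ℝ) + ((k + 1 : ℕ) : ℝ) = (n + k) + 1 := by push_cast; ring
  have p1 : 0 < (n : ℝ) + s + k := by linarith
  have p2 : 0 < (n : ℝ) + k := by linarith
  unfold derivCoeff
  rw [if_pos (Or.inr (by push_cast; linarith)), if_pos (Or.inr (by linarith)), e1, e2,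
    Real.Gamma_add_one p1.ne', Real.Gamma_add_one p2.ne']
  have g1 := Real.Gamma_pos_of_pos p1
  have g2 := Real.Gamma_pos_of_pos p2
  rw [abs_of_pos (by positivity), abs_of_pos (by positivity), mul_div_mul_comm]
  gcongr
  rw [div_le_iff₀ p2]
  linarith

/-- The series defining `ℐ^s f` converges absolutely. -/
theorem summable_fracInteg {n : ℕ} (s : ℝ) {f : Cn n → ℂ} (hf : Differentiable ℂ f) (z : Cn n) :
    Summable fun k => (integCoeff n s k : ℂ) * homogPart k f z := by
  obtain ⟨N, hN⟩ := exists_nat_gt (2 * |s| + 1)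
  refine summable_aux hf z _ N fun k hk => ?_
  have hk' : (N : ℝ) ≤ k := by exact_mod_cast hk
  have hs := neg_abs_le s
  have hs' := le_abs_self s
  have hs0 := abs_nonneg s
  have hn : (0 : ℝ) ≤ n := Nat.cast_nonneg n
  have e1 : (n : ℝ) + s + ((k + 1 : ℕ) : ℝ) = (n + s + k) + 1 := by push_cast; ring
  have e2 : (n : ℝ) + ((k + 1 : ℕ) : ℝ) = (n + k) + 1 := by push_cast; ring
  have p1 : 0 < (n : ℝ) + s + k := by linarith
  have p2 : 0 < (n : ℝ) + k := by linarith
  unfold integCoeff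
  rw [if_pos (Or.inr (by push_cast; linarith)), if_pos (Or.inr (by linarith)), e1, e2,
    Real.Gamma_add_one p1.ne', Real.Gamma_add_one p2.ne']
  have g1 := Real.Gamma_pos_of_pos p1
  have g2 := Real.Gamma_pos_of_pos p2
  rw [abs_of_pos (by positivity), abs_of_pos (by positivity), mul_div_mul_comm]
  gcongr
  rw [div_le_iff₀ p1]
  linarith

/-- The operator `T` is bounded from `F^p_α` to `F^p_β`: it restricts to a linear map between these
spaces, and `‖T f‖_{F^p_β} ≤ C ‖f‖_{F^p_α}` with a finite constant `C` independent of `f`. -/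
def IsBoundedFock (n : ℕ) (p : ℝ≥0∞) (α β : ℝ) (T : (Cn n → ℂ) → Cn n → ℂ) : Prop :=
  ∃ L : fock n p α →ₗ[ℂ] fock n p β, (∀ f, (L f : Cn n → ℂ) = T f) ∧
    ∃ C : ℝ≥0, ∀ f : fock n p α, fockNorm n p β (L f) ≤ C * fockNorm n p α f

end FockSobolev

end

noncomputable section

namespace FockSobolev

/-! ### Sub-mean value property of `|g|^p` -/

/-! Both operators multiply `f_k` by a sequence `m_k` that behaves like `k^s`. Everything happens on
complex lines: with `g(t) = f(tz)`, the value of the image at `z` is `∑ m_k g_k`, where `g_k` are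
the Taylor coefficients of `g`. Put `q = (1+|z|)^2`. If `f` grows like `e^{|z|²/2}`, then near
`[1/4, 1]` the function `g` is at most about `e^{|z|²/2} e^{-c(1-t)q}`: it lives within distance
`1/q` of `t = 1`. A multiplier has order `d` (`SliceBound`) if it costs a factor `q^d =
(1+|z|)^{2d}` on such functions, which is the required shift of the weight.

Two multipliers are treated directly. The sequence `k + c` gives `g'(1) + c g(1)`, and Cauchy's
estimate at scale `1/q` gives order `1` (`sliceBound_natCast_add`). The quotient `Γ(a+k)/Γ(a+σ+k)`,
`σ ≥ 1`, is up to a constant a Beta integral, so the sum is `∫ t^{a-1}(1-t)^{σ-1} g(t) dt`, of size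
`q^{-σ}` (`sliceBound_gammaRatio`). The part of this integral over `[0, 1/4]` and finitely many
exceptional indices only change `m_k` by `O(4^{-k})`, which is controlled by `g` on `|w| = 1/2`.

For `p = ∞` the pointwise growth of `f` is inserted directly. For `p < ∞` the suprema of `g` are
replaced by integrals of `|g|^p` over discs of radius comparable to `1/q`, by a sub-mean value
property valid for every `p > 0`. Integrating over `z` and substituting `z ↦ z/w` reduces the bound
to a Schur-type condition on a kernel on the line (`lintegral_lintegral_slice_le`,
`lintegral_lineKernel_le`).

Finally, `Γ(n+s+k)/Γ(n+k)` is a product of `N` linear factors in `k` and a quotient of order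
`-(N-s)`. Since the weight parameter ranges over all reals, the bounded maps compose
(`HasOrder.mul`). -/

theorem two_pi_mul_enorm_le_lintegral_circle {g : ℂ → ℂ} (hg : Differentiable ℂ g) (ρ : ℝ) :
    ENNReal.ofReal (2 * Real.pi) * ‖g 0‖ₑ ≤
      ∫⁻ θ in Set.Ioo (-Real.pi) Real.pi, ‖g (Complex.polarCoord.symm (ρ, θ))‖ₑ := by
  have h1 : Real.circleAverage g 0 ρ = g 0 := (hg.diffContOnCl).circleAverage
  rw [Real.circleAverage_eq_integral_add (-Real.pi),
    intervalIntegral.integral_comp_add_right (fun θ => g (circleMap 0 ρ θ)), zero_add,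
    show 2 * Real.pi + -Real.pi = Real.pi by ring,
    intervalIntegral.integral_of_le (by linarith [Real.pi_pos]), integral_Ioc_eq_integral_Ioo] at h1
  have h2 : (2 * Real.pi : ℝ) • g 0 =
      ∫ θ in Set.Ioo (-Real.pi) Real.pi, g (circleMap 0 ρ θ) := by
    rw [← h1, smul_smul, mul_inv_cancel₀ (by positivity), one_smul]
  have h3 := enorm_integral_le_lintegral_enorm (μ := volume.restrict (Set.Ioo (-Real.pi) Real.pi))
    (fun θ => g (circleMap 0 ρ θ))
  rw [← h2, enorm_smul, Real.enorm_of_nonneg (by positivity)] at h3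
  refine h3.trans (le_of_eq (lintegral_congr fun θ => ?_))
  rw [Complex.polarCoord_symm_apply, circleMap_zero, Complex.exp_mul_I]
  simp

/-- The mean value inequality on circles is integrated over the radius in polar coordinates. -/
theorem mul_enorm_le_lintegral_ball_zero {g : ℂ → ℂ} (hg : Differentiable ℂ g) {r : ℝ}
    (hr : 0 < r) :
    ENNReal.ofReal (Real.pi * r ^ 2) * ‖g 0‖ₑ ≤ ∫⁻ w in Metric.ball 0 r, ‖g w‖ₑ := by
  rw [← lintegral_indicator Metric.isOpen_ball.measurableSet, ← Complex.lintegral_comp_polarCoord_symm,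
    polarCoord_target, Measure.volume_eq_prod, ← Measure.prod_restrict, lintegral_prod]
  · calc ENNReal.ofReal (Real.pi * r ^ 2) * ‖g 0‖ₑ
        = ∫⁻ ρ in Set.Ioo 0 r, ENNReal.ofReal ρ * (ENNReal.ofReal (2 * Real.pi) * ‖g 0‖ₑ) := by
          rw [lintegral_mul_const _ (by fun_prop), ← mul_assoc, ← ofReal_integral_eq_lintegral_ofReal,
            ← ENNReal.ofReal_mul', ← integral_Ioc_eq_integral_Ioo,
            ← intervalIntegral.integral_of_le hr.le, integral_id]
          · congr 2; ring
          · positivity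
          · exact (continuous_id.integrableOn_Icc).mono_set Set.Ioo_subset_Icc_self
          · filter_upwards [ae_restrict_mem measurableSet_Ioo] with x hx using hx.1.le
      _ ≤ ∫⁻ ρ in Set.Ioo 0 r, ∫⁻ θ in Set.Ioo (-Real.pi) Real.pi, ENNReal.ofReal ρ •
            (Metric.ball 0 r).indicator (fun w => ‖g w‖ₑ) (Complex.polarCoord.symm (ρ, θ)) := by
          refine setLIntegral_mono' measurableSet_Ioo fun ρ hρ => ?_
          simp only [smul_eq_mul]
          rw [lintegral_const_mul']
          swap; · simp
          gcongr
          refine (two_pi_mul_enorm_le_lintegral_circle hg ρ).trans (le_of_eq ?_)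
          refine lintegral_congr fun θ => ?_
          rw [Set.indicator_of_mem]
          rw [mem_ball_zero_iff, Complex.norm_polarCoord_symm, abs_of_pos hρ.1]
          exact hρ.2
      _ ≤ _ := lintegral_mono_set Set.Ioo_subset_Ioi_self
  · have h1 : Measurable fun q : ℝ × ℝ => Complex.polarCoord.symm q := by
      simp only [Complex.polarCoord_symm_apply]
      fun_prop
    exact ((measurable_fst.ennreal_ofReal).smul (((hg.continuous.measurable.enorm).indicator
      Metric.isOpen_ball.measurableSet).comp h1)).aemeasurable

theorem mul_enorm_le_lintegral_ball {g : ℂ → ℂ} (hg : Differentiable ℂ g) (c : ℂ) {r : ℝ}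
    (hr : 0 < r) :
    ENNReal.ofReal (Real.pi * r ^ 2) * ‖g c‖ₑ ≤ ∫⁻ w in Metric.ball c r, ‖g w‖ₑ := by
  have h := mul_enorm_le_lintegral_ball_zero (g := fun w => g (c + w)) (hg.comp (by fun_prop)) hr
  rw [add_zero] at h
  refine h.trans (le_of_eq ?_)
  rw [← lintegral_indicator Metric.isOpen_ball.measurableSet,
    ← lintegral_indicator Metric.isOpen_ball.measurableSet,
    ← lintegral_add_left_eq_self ((Metric.ball c r).indicator fun w => ‖g w‖ₑ) c]
  refine lintegral_congr fun w => ?_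
  by_cases hw : ‖w‖ < r <;> simp [Set.indicator, hw]

/-- Hölder's inequality on the disc bounds the `L^1` integral by the `L^p` one. After raising to the
power `p`, a factor `V ^ (p - 1)` of the area `V` cancels. -/
theorem rpow_enorm_le_lintegral_ball_of_one_le {p : ℝ} (hp : 1 ≤ p) {g : ℂ → ℂ}
    (hg : Differentiable ℂ g) (c : ℂ) {r : ℝ} (hr : 0 < r) :
    ENNReal.ofReal (Real.pi * r ^ 2) * ‖g c‖ₑ ^ p ≤ ∫⁻ w in Metric.ball c r, ‖g w‖ₑ ^ p := by
  have h1 := mul_enorm_le_lintegral_ball hg c hr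
  have h2 := eLpNorm'_le_eLpNorm'_mul_rpow_measure_univ (μ := volume.restrict (Metric.ball c r))
    one_pos hp hg.continuous.aestronglyMeasurable
  have hV : volume.restrict (Metric.ball c r) Set.univ = ENNReal.ofReal (Real.pi * r ^ 2) := by
    rw [Measure.restrict_apply_univ, Complex.volume_ball, mul_comm, ENNReal.ofReal_mul (by positivity),
      ENNReal.ofReal_pow hr.le]
    congr 1
    rw [← NNReal.coe_real_pi, ENNReal.ofReal_coe_nnreal]
  rw [hV] at h2
  set V := ENNReal.ofReal (Real.pi * r ^ 2)
  have hV0 : V ≠ 0 := by simp only [V]; positivity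
  have hVt : V ≠ ∞ := ENNReal.ofReal_ne_top
  simp only [eLpNorm'_eq_lintegral_enorm, ENNReal.rpow_one, div_one] at h2
  have h3 := ENNReal.rpow_le_rpow (h1.trans h2) (zero_le_one.trans hp)
  have hp0 : p ≠ 0 := by linarith
  rw [ENNReal.mul_rpow_of_nonneg _ _ (by linarith), ENNReal.mul_rpow_of_nonneg _ _ (by linarith),
    ← ENNReal.rpow_mul, ← ENNReal.rpow_mul, one_div, inv_mul_cancel₀ hp0, ENNReal.rpow_one,
    show (1 - p⁻¹) * p = p - 1 by field_simp] at h3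
  have h4 : V ^ p = V * V ^ (p - 1) := by
    conv_rhs => rw [← ENNReal.rpow_one V]
    rw [← ENNReal.rpow_mul, one_mul, ← ENNReal.rpow_add _ _ hV0 hVt]
    congr 1; ring
  rw [h4, mul_right_comm] at h3
  exact (ENNReal.mul_le_mul_iff_left (by simp [hV0, hVt]) (by simp [hV0, hVt])).mp h3

/-- The sub-mean value property for exponents below `1`, by maximizing `(r - |w - c|)^{2/p} |g w|`. -/
theorem rpow_enorm_le_lintegral_ball_of_lt_one {p : ℝ} (hp0 : 0 < p) (hp : p < 1) {g : ℂ → ℂ}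
    (hg : Differentiable ℂ g) (c : ℂ) {r : ℝ} (hr : 0 < r) :
    ENNReal.ofReal (Real.pi * r ^ 2) * ‖g c‖ₑ ^ p ≤
      ENNReal.ofReal (4 * 2 ^ (2 / p * (1 - p))) * ∫⁻ w in Metric.ball c r, ‖g w‖ₑ ^ p := by
  by_cases hgc : g c = 0
  · simp [hgc, hp0]
  -- The exponent `2 / p` is chosen so that the `p`-th power of the weight is the squared distance
  -- to the boundary, which scales like the area of the disc around the maximizer used below.
  have hφ : Continuous fun w => |r - dist w c| ^ (2 / p) * ‖g w‖ :=
    (Continuous.rpow_const (by fun_prop) fun _ => Or.inr (by positivity)).mul hg.continuous.norm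
  obtain ⟨w₀, hw₀, hmax⟩ := (isCompact_closedBall c r).exists_isMaxOn
    ⟨c, Metric.mem_closedBall_self hr.le⟩ hφ.continuousOn
  have hmax' : ∀ w ∈ Metric.closedBall c r,
      (r - dist w c) ^ (2 / p) * ‖g w‖ ≤ (r - dist w₀ c) ^ (2 / p) * ‖g w₀‖ := by
    intro w hw
    have := isMaxOn_iff.1 hmax w hw
    rwa [abs_of_nonneg (sub_nonneg.2 hw), abs_of_nonneg (sub_nonneg.2 hw₀)] at this
  set d := r - dist w₀ c with hd
  have hd0 : 0 ≤ d := sub_nonneg.2 hw₀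
  have hc := hmax' c (Metric.mem_closedBall_self hr.le)
  rw [dist_self, sub_zero] at hc
  have hpos : 0 < r ^ (2 / p) * ‖g c‖ := by positivity
  have hdpos : 0 < d := by
    rcases hd0.eq_or_lt with h | h
    · rw [← h, Real.zero_rpow (by positivity), zero_mul] at hc
      linarith
    · exact h
  have hG : 0 < ‖g w₀‖ := by
    by_contra hcon
    have : ‖g w₀‖ = 0 := le_antisymm (not_lt.1 hcon) (norm_nonneg _)
    rw [this, mul_zero] at hc
    linarith
  set G := ‖g w₀‖ with hGdef
  have hsub : Metric.ball w₀ (d / 2) ⊆ Metric.ball c r := by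
    intro w hw
    have h1 := dist_triangle w w₀ c
    have h2 : dist w w₀ < d / 2 := hw
    rw [Metric.mem_ball]
    linarith
  -- On the half-size disc the distance to the boundary is still at least `d / 2`, so maximality
  -- bounds `|g|` there by a multiple of its value `G` at the maximizer. This allows `|g|` to be
  -- replaced by `|g|^p` times `G^(1-p)` in the `p = 1` inequality.
  have hloc : ∀ w ∈ Metric.ball w₀ (d / 2), ‖g w‖ ≤ 2 ^ (2 / p) * G := by
    intro w hw
    have h1 := dist_triangle w w₀ c
    have h2 : dist w w₀ < d / 2 := hw
    have h3 := hmax' w (Metric.ball_subset_closedBall (hsub hw))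
    have h4 : (d / 2) ^ (2 / p) ≤ (r - dist w c) ^ (2 / p) :=
      Real.rpow_le_rpow (by positivity) (by linarith) (by positivity)
    have h5 : (d / 2) ^ (2 / p) * ‖g w‖ ≤ d ^ (2 / p) * G := le_trans (by gcongr) h3
    rw [Real.div_rpow hd0 (by norm_num), div_mul_eq_mul_div, div_le_iff₀ (by positivity)] at h5
    have h6 : 0 < d ^ (2 / p) := by positivity
    nlinarith
  have hq : 0 < 1 - p := by linarith
  have hint : ∫⁻ w in Metric.ball w₀ (d / 2), ‖g w‖ₑ ≤
      ENNReal.ofReal ((2 ^ (2 / p) * G) ^ (1 - p)) * ∫⁻ w in Metric.ball c r, ‖g w‖ₑ ^ p := by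
    rw [← lintegral_const_mul' _ _ ENNReal.ofReal_ne_top]
    refine (setLIntegral_mono' measurableSet_ball fun w hw => ?_).trans
      (lintegral_mono_set hsub)
    rw [← ofReal_norm, ENNReal.ofReal_rpow_of_nonneg (norm_nonneg _) hp0.le,
      ← ENNReal.ofReal_mul (by positivity)]
    refine ENNReal.ofReal_le_ofReal ?_
    calc ‖g w‖ = ‖g w‖ ^ (1 - p) * ‖g w‖ ^ p := by
          rw [← Real.rpow_add_of_nonneg (norm_nonneg _) hq.le hp0.le]; simp
      _ ≤ _ := by gcongr; exact hloc w hw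
  have h1 := (mul_enorm_le_lintegral_ball hg w₀ (half_pos hdpos)).trans hint
  have h2 : r ^ 2 * ‖g c‖ ^ p ≤ d ^ 2 * G ^ p := by
    have h := Real.rpow_le_rpow hpos.le hc hp0.le
    rw [Real.mul_rpow (by positivity) (by positivity), Real.mul_rpow (by positivity) (by positivity),
      ← Real.rpow_mul hr.le, ← Real.rpow_mul hd0, div_mul_cancel₀ _ hp0.ne'] at h
    simpa using h
  set I := ∫⁻ w in Metric.ball c r, ‖g w‖ₑ ^ p
  have hGpow : G ^ p * G ^ (1 - p) = G := by
    rw [← Real.rpow_add hG]; simp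
  have h3 : ENNReal.ofReal (Real.pi * d ^ 2 * G ^ p) ≤
      ENNReal.ofReal (4 * 2 ^ (2 / p * (1 - p))) * I := by
    have hK : 0 < G ^ (1 - p) := by positivity
    rw [← ofReal_norm, ← ENNReal.ofReal_mul (by positivity)] at h1
    refine (ENNReal.mul_le_mul_iff_right (a := ENNReal.ofReal (G ^ (1 - p) / 4))
      (by simpa using hK) ENNReal.ofReal_ne_top).mp ?_
    rw [← ENNReal.ofReal_mul (by positivity), ← mul_assoc (ENNReal.ofReal _) (ENNReal.ofReal _) I,
      ← ENNReal.ofReal_mul (by positivity)]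
    refine (le_of_eq ?_).trans (h1.trans (le_of_eq ?_))
    · congr 1
      calc G ^ (1 - p) / 4 * (Real.pi * d ^ 2 * G ^ p)
          = Real.pi * (d / 2) ^ 2 * (G ^ p * G ^ (1 - p)) := by ring
        _ = _ := by rw [hGpow]
    · congr 2
      rw [Real.mul_rpow (by positivity) hG.le, ← Real.rpow_mul (by norm_num)]
      ring
  refine le_trans ?_ h3
  rw [← ofReal_norm, ENNReal.ofReal_rpow_of_nonneg (norm_nonneg _) hp0.le,
    ← ENNReal.ofReal_mul (by positivity)]
  refine ENNReal.ofReal_le_ofReal ?_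
  rw [mul_assoc, mul_assoc]
  gcongr

/-- `|g|^p` satisfies a sub-mean value property with a constant depending only on `p`. -/
theorem exists_rpow_enorm_le_lintegral_ball {p : ℝ} (hp : 0 < p) :
    ∃ C : ℝ, 0 < C ∧ ∀ g : ℂ → ℂ, Differentiable ℂ g → ∀ (c : ℂ) (r : ℝ), 0 < r →
      ‖g c‖ₑ ^ p ≤ ENNReal.ofReal (C / r ^ 2) * ∫⁻ w in Metric.ball c r, ‖g w‖ₑ ^ p := by
  have key : ∃ C : ℝ, 0 < C ∧ ∀ g : ℂ → ℂ, Differentiable ℂ g → ∀ (c : ℂ) (r : ℝ), 0 < r →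
      ENNReal.ofReal (Real.pi * r ^ 2) * ‖g c‖ₑ ^ p ≤
        ENNReal.ofReal C * ∫⁻ w in Metric.ball c r, ‖g w‖ₑ ^ p := by
    rcases lt_or_ge p 1 with h | h
    · exact ⟨_, by positivity, fun g hg c r hr => rpow_enorm_le_lintegral_ball_of_lt_one hp h hg c hr⟩
    · exact ⟨1, one_pos, fun g hg c r hr => by
        simpa using rpow_enorm_le_lintegral_ball_of_one_le h hg c hr⟩
  obtain ⟨C, hC, h⟩ := key
  refine ⟨C / Real.pi, by positivity, fun g hg c r hr => ?_⟩
  have hpos : 0 < Real.pi * r ^ 2 := by positivity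
  refine (ENNReal.mul_le_mul_iff_right (a := ENNReal.ofReal (Real.pi * r ^ 2))
    (by simpa using hpos) ENNReal.ofReal_ne_top).mp ?_
  rw [← mul_assoc, ← ENNReal.ofReal_mul hpos.le,
    show Real.pi * r ^ 2 * (C / Real.pi / r ^ 2) = C by field_simp]
  exact h g hg c r hr

/-! ### Radial multipliers -/

/-- The radial multiplier operator `∑ f_k ↦ ∑ m_k f_k`. -/
def mulOp {n : ℕ} (m : ℕ → ℝ) (f : Cn n → ℂ) (z : Cn n) : ℂ :=
  ∑' k : ℕ, (m k : ℂ) * homogPart k f z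

/-- Multiplier sequences of subexponential growth. -/
def SubExp (m : ℕ → ℝ) : Prop := ∀ r : ℝ, 1 < r → ∃ C : ℝ, 0 ≤ C ∧ ∀ k, |m k| ≤ C * r ^ k

theorem SubExp.mul {m m' : ℕ → ℝ} (h : SubExp m) (h' : SubExp m') :
    SubExp fun k => m k * m' k := by
  intro r hr
  have hs : 1 < √r := by rw [Real.lt_sqrt] <;> simp [hr]
  obtain ⟨C, hC, hm⟩ := h _ hs
  obtain ⟨C', hC', hm'⟩ := h' _ hs
  refine ⟨C * C', by positivity, fun k => ?_⟩
  rw [abs_mul]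
  calc |m k| * |m' k| ≤ (C * √r ^ k) * (C' * √r ^ k) :=
        mul_le_mul (hm k) (hm' k) (abs_nonneg _) (by positivity)
    _ = C * C' * (√r * √r) ^ k := by rw [mul_pow]; ring
    _ = _ := by rw [Real.mul_self_sqrt (by linarith)]

theorem subExp_of_bounded {m : ℕ → ℝ} {C : ℝ} (h : ∀ k, |m k| ≤ C) : SubExp m := by
  intro r hr
  have hC : 0 ≤ C := (abs_nonneg _).trans (h 0)
  exact ⟨C, hC, fun k => (h k).trans (le_mul_of_one_le_right hC (one_le_pow₀ hr.le))⟩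

theorem subExp_natCast_add (c : ℝ) : SubExp fun k => (k : ℝ) + c := by
  intro r hr
  have hr' : 0 < r - 1 := by linarith
  refine ⟨1 / (r - 1) + |c|, by positivity, fun k => ?_⟩
  have h1 := one_add_mul_le_pow (a := r - 1) (by linarith) k
  rw [add_sub_cancel] at h1
  have h2 : (1 : ℝ) ≤ r ^ k := one_le_pow₀ hr.le
  have h3 : (k : ℝ) ≤ 1 / (r - 1) * r ^ k := by
    rw [div_mul_eq_mul_div, le_div_iff₀ hr']
    linarith
  calc |(k : ℝ) + c| ≤ k + |c| := (abs_add_le _ _).trans (by simp)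
    _ ≤ _ := by nlinarith [abs_nonneg c]

/-- The Taylor coefficient of `g` at `0`. -/
def taylorCoeff (k : ℕ) (g : ℂ → ℂ) : ℂ := ((k.factorial : ℂ))⁻¹ * iteratedDeriv k g 0

theorem hasSum_taylorCoeff {g : ℂ → ℂ} (hg : Differentiable ℂ g) (t : ℂ) :
    HasSum (fun k => taylorCoeff k g * t ^ k) (g t) := by
  have h := Complex.hasSum_taylorSeries_of_entire hg 0 t
  have e : (fun k => taylorCoeff k g * t ^ k) = fun k : ℕ => ((k.factorial : ℂ))⁻¹ •
      (t - 0) ^ k • iteratedDeriv k g 0 := by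
    funext k
    simp only [taylorCoeff, sub_zero, smul_eq_mul]
    ring
  rw [e]
  exact h

theorem eq_taylorCoeff_of_hasSum {g : ℂ → ℂ} (hg : Differentiable ℂ g) {a : ℕ → ℂ}
    (ha : ∀ t, HasSum (fun k => a k * t ^ k) (g t)) (k : ℕ) : a k = taylorCoeff k g := by
  have key : ∀ a : ℕ → ℂ, (∀ t : ℂ, HasSum (fun k => a k * t ^ k) (g t)) →
      HasFPowerSeriesAt g (FormalMultilinearSeries.ofScalars ℂ a) 0 := by
    intro a ha
    rw [hasFPowerSeriesAt_iff]
    refine Filter.Eventually.of_forall fun t => ?_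
    simpa [FormalMultilinearSeries.coeff_ofScalars, mul_comm] using ha t
  have h3 := congrArg (fun p => p.coeff k)
    ((key _ ha).eq_formalMultilinearSeries (key _ (hasSum_taylorCoeff hg)))
  simpa [FormalMultilinearSeries.coeff_ofScalars] using h3

theorem homogPart_eq_taylorCoeff {n : ℕ} (k : ℕ) (f : Cn n → ℂ) (z : Cn n) :
    homogPart k f z = taylorCoeff k fun t => f (t • z) := rfl

theorem differentiable_slice {n : ℕ} {f : Cn n → ℂ} (hf : Differentiable ℂ f) (z : Cn n) :
    Differentiable ℂ fun t : ℂ => f (t • z) := hf.comp (by fun_prop)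

/-- Cauchy's estimate for Taylor coefficients. -/
theorem norm_taylorCoeff_le {g : ℂ → ℂ} (hg : Differentiable ℂ g) {R M : ℝ} (hR : 0 < R)
    (hM : ∀ t, ‖t‖ = R → ‖g t‖ ≤ M) (k : ℕ) : ‖taylorCoeff k g‖ ≤ M / R ^ k := by
  have h := Complex.norm_iteratedDeriv_le_of_forall_mem_sphere_norm_le (c := 0) k hR
    hg.diffContOnCl (fun z hz => hM z (by simpa using hz))
  rw [taylorCoeff, norm_mul, norm_inv, Complex.norm_natCast, inv_mul_le_iff₀ (by positivity)]
  rwa [mul_div_assoc] at h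

theorem SubExp.summable {m : ℕ → ℝ} (hm : SubExp m) {g : ℂ → ℂ} (hg : Differentiable ℂ g) :
    Summable fun k => (m k : ℂ) * taylorCoeff k g := by
  obtain ⟨C, hC, h⟩ := hm 2 one_lt_two
  refine Summable.of_norm_bounded ((hasSum_taylorCoeff hg 2).summable.norm.mul_left C) fun k => ?_
  rw [norm_mul, norm_mul, norm_pow, Complex.norm_real, Real.norm_eq_abs, Complex.norm_ofNat]
  calc |m k| * ‖taylorCoeff k g‖ ≤ C * 2 ^ k * ‖taylorCoeff k g‖ := by gcongr; exact h k
    _ = _ := by ring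

/-- Cauchy's estimate for the derivative of an entire function of several variables. -/
theorem norm_fderiv_le_of_forall_ball {n : ℕ} {f : Cn n → ℂ} (hf : Differentiable ℂ f) {R M : ℝ}
    (hM : ∀ z, ‖z‖ ≤ R + 1 → ‖f z‖ ≤ M) {z : Cn n} (hz : ‖z‖ ≤ R) : ‖fderiv ℂ f z‖ ≤ M := by
  have hM0 : 0 ≤ M := (norm_nonneg _).trans (hM z (by linarith))
  refine ContinuousLinearMap.opNorm_le_of_unit_norm (𝕜 := ℂ) hM0 fun v hv => ?_
  have hd : Differentiable ℂ fun t : ℂ => z + t • v := by fun_prop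
  have h1 : HasDerivAt (fun t : ℂ => f (z + t • v)) (fderiv ℂ f z v) 0 := by
    have h2 : HasDerivAt (fun t : ℂ => z + t • v) v 0 := by
      simpa using ((hasDerivAt_id (0 : ℂ)).smul_const v).const_add z
    have h3 : HasFDerivAt f (fderiv ℂ f z) (z + (0 : ℂ) • v) := by
      simpa using (hf z).hasFDerivAt
    exact h3.comp_hasDerivAt (0 : ℂ) h2
  have h4 := Complex.norm_deriv_le_of_forall_mem_sphere_norm_le (c := 0) (R := 1) (C := M)
    (f := fun t : ℂ => f (z + t • v)) one_pos (hf.comp hd).diffContOnCl fun t ht => by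
      refine hM _ ((norm_add_le _ _).trans ?_)
      rw [norm_smul, hv, mul_one]
      have : ‖t‖ = 1 := by simpa using ht
      linarith
  rwa [h1.deriv, div_one] at h4

theorem exists_bound_on_ball {n : ℕ} {f : Cn n → ℂ} (hf : Continuous f) (R : ℝ) :
    ∃ M : ℝ, 0 ≤ M ∧ ∀ z, ‖z‖ ≤ R → ‖f z‖ ≤ M := by
  obtain ⟨M, hM⟩ := (isCompact_closedBall (0 : Cn n) R).exists_bound_of_continuousOn hf.continuousOn
  exact ⟨max M 0, le_max_right _ _, fun z hz => (hM z (by simpa using hz)).trans (le_max_left _ _)⟩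

/-! ### Holomorphy and algebra of radial multipliers -/

/-- Cauchy's formula on the unit circle moves the dependence on `z` inside `f`, so that the
components can be differentiated in `z` under the integral sign. -/
theorem homogPart_eq_intervalIntegral {n : ℕ} {f : Cn n → ℂ} (hf : Differentiable ℂ f) (k : ℕ)
    (z : Cn n) : homogPart k f z = ∫ θ in (0 : ℝ)..2 * Real.pi,
      (2 * Real.pi : ℂ)⁻¹ * (circleMap 0 1 θ ^ k)⁻¹ * f (circleMap 0 1 θ • z) := by
  have h := ((differentiable_slice hf z).differentiableOn (s := Metric.closedBall 0 1)
    ).circleIntegral_one_div_sub_center_pow_smul one_pos k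
  rw [homogPart]
  have hpi : (2 * Real.pi * Complex.I : ℂ) ≠ 0 := Complex.two_pi_I_ne_zero
  have e : iteratedDeriv k (fun t : ℂ => f (t • z)) 0 =
      (k.factorial : ℂ) / (2 * Real.pi * Complex.I) *
        ∮ w in C(0, 1), (1 / (w - 0) ^ (k + 1)) • f (w • z) := by
    rw [h, smul_eq_mul]
    have := Nat.factorial_ne_zero k
    field_simp
  rw [e, circleIntegral, ← mul_assoc, ← intervalIntegral.integral_const_mul]
  refine intervalIntegral.integral_congr fun θ _ => ?_
  have hc : circleMap 0 1 θ ≠ 0 := by simp [circleMap]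
  have := Nat.factorial_ne_zero k
  simp only [deriv_circleMap, smul_eq_mul, sub_zero]
  field_simp
  ring

theorem differentiable_homogPart {n : ℕ} {f : Cn n → ℂ} (hf : Differentiable ℂ f) (k : ℕ) :
    Differentiable ℂ (homogPart k f) := by
  intro z₀
  -- One unit of radius is for `z` moving near `z₀`, the other for Cauchy's estimate of `fderiv`.
  obtain ⟨M, hM0, hM⟩ := exists_bound_on_ball hf.continuous (‖z₀‖ + 1 + 1)
  have e : homogPart k f = fun z => ∫ θ in (0 : ℝ)..2 * Real.pi,
      (2 * Real.pi : ℂ)⁻¹ * (circleMap 0 1 θ ^ k)⁻¹ * f (circleMap 0 1 θ • z) :=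
    funext fun z => homogPart_eq_intervalIntegral hf k z
  have hc : ∀ θ, circleMap 0 1 θ ^ k ≠ 0 := fun θ => by simp [circleMap]
  have hcoef : Continuous fun θ => (2 * Real.pi : ℂ)⁻¹ * (circleMap 0 1 θ ^ k)⁻¹ :=
    continuous_const.mul (((continuous_circleMap 0 1).pow k).inv₀ hc)
  have hcont : ∀ z, Continuous fun θ =>
      (2 * Real.pi : ℂ)⁻¹ * (circleMap 0 1 θ ^ k)⁻¹ * f (circleMap 0 1 θ • z) := fun z =>
    hcoef.mul (hf.continuous.comp ((continuous_circleMap 0 1).smul continuous_const))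
  rw [e]
  refine HasFDerivAt.differentiableAt (intervalIntegral.hasFDerivAt_integral_of_dominated_of_fderiv_le
    (F' := fun z θ => ((2 * Real.pi : ℂ)⁻¹ * (circleMap 0 1 θ ^ k)⁻¹) •
      (circleMap 0 1 θ • fderiv ℂ f (circleMap 0 1 θ • z)))
    (bound := fun _ => (2 * Real.pi)⁻¹ * M) (s := Metric.ball z₀ 1) (Metric.ball_mem_nhds _ one_pos)
    (Filter.Eventually.of_forall fun z => (hcont z).aestronglyMeasurable)
    ((hcont z₀).intervalIntegrable _ _) ?_ ?_ (by simp) ?_)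
  · refine Measurable.aestronglyMeasurable ?_
    exact hcoef.measurable.smul ((continuous_circleMap 0 1).measurable.smul
      ((measurable_fderiv ℂ f).comp
        ((continuous_circleMap 0 1).smul continuous_const).measurable))
  · refine Filter.Eventually.of_forall fun θ _ z hz => ?_
    have hz' : ‖z‖ ≤ ‖z₀‖ + 1 := by
      have h1 : ‖z - z₀‖ < 1 := by simpa [dist_eq_norm] using hz
      have h2 := norm_add_le (z - z₀) z₀
      rw [sub_add_cancel] at h2
      linarith
    have h1 := norm_fderiv_le_of_forall_ball hf hM (z := circleMap 0 1 θ • z)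
      (by rw [norm_smul, norm_circleMap_zero]; simpa using hz')
    rw [norm_smul, norm_smul, norm_mul, norm_inv, norm_inv, norm_pow, norm_circleMap_zero]
    have h2 : ‖(2 * Real.pi : ℂ)‖ = 2 * Real.pi := by simp [abs_of_pos Real.pi_pos]
    rw [h2]
    simp only [abs_one, one_pow, inv_one, mul_one, one_mul]
    gcongr
  · refine Filter.Eventually.of_forall fun θ _ z _ => ?_
    have h1 : HasFDerivAt (fun z : Cn n => circleMap 0 1 θ • z)
        (circleMap 0 1 θ • ContinuousLinearMap.id ℂ (Cn n)) z :=
      (circleMap 0 1 θ • ContinuousLinearMap.id ℂ (Cn n)).hasFDerivAt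
    have h2 := (((hf (circleMap 0 1 θ • z)).hasFDerivAt.comp z h1)).const_mul
      ((2 * Real.pi : ℂ)⁻¹ * (circleMap 0 1 θ ^ k)⁻¹)
    have e2 : circleMap 0 1 θ • fderiv ℂ f (circleMap 0 1 θ • z) =
        (fderiv ℂ f (circleMap 0 1 θ • z)).comp
          (circleMap 0 1 θ • ContinuousLinearMap.id ℂ (Cn n)) := by
      ext v
      simp
    rw [e2]
    exact h2

theorem norm_homogPart_le {n : ℕ} {f : Cn n → ℂ} (hf : Differentiable ℂ f) {R r M : ℝ} (hr : 0 < r)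
    (hM : ∀ z, ‖z‖ ≤ r * R → ‖f z‖ ≤ M) {z : Cn n} (hz : ‖z‖ ≤ R) (k : ℕ) :
    ‖homogPart k f z‖ ≤ M / r ^ k := by
  refine norm_taylorCoeff_le (differentiable_slice hf z) hr (fun t ht => hM _ ?_) k
  rw [norm_smul, ht]
  gcongr

theorem differentiable_mulOp {n : ℕ} {m : ℕ → ℝ} (hm : SubExp m) {f : Cn n → ℂ}
    (hf : Differentiable ℂ f) : Differentiable ℂ (mulOp m f) := by
  intro z₀
  obtain ⟨C, hC, hmC⟩ := hm 2 one_lt_two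
  -- Bounding `f` on a ball dilated by `4` gives `|f_k| ≤ M / 4^k`. Against `|m k| ≤ C * 2^k` this
  -- leaves a geometric series of ratio `1/2`.
  obtain ⟨M, hM0, hM⟩ := exists_bound_on_ball hf.continuous (4 * (‖z₀‖ + 1 + 1))
  refine HasFDerivAt.differentiableAt (hasFDerivAt_tsum_of_isPreconnected (𝕜 := ℂ)
    (f := fun k z => (m k : ℂ) * homogPart k f z)
    (f' := fun k z => (m k : ℂ) • fderiv ℂ (homogPart k f) z)
    (u := fun k => C * M * (1 / 2) ^ k) (s := Metric.ball 0 (‖z₀‖ + 1)) (x₀ := z₀)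
    ((summable_geometric_of_lt_one (by norm_num) (by norm_num)).mul_left _)
    Metric.isOpen_ball (convex_ball _ _).isPreconnected ?_ ?_ ?_ ?_ ?_)
  · exact fun k z _ => ((differentiable_homogPart hf k z).hasFDerivAt).const_mul _
  · intro k z hz
    have h1 : ‖fderiv ℂ (homogPart k f) z‖ ≤ M / 4 ^ k :=
      norm_fderiv_le_of_forall_ball (differentiable_homogPart hf k) (R := ‖z₀‖ + 1)
        (fun w hw => norm_homogPart_le hf (by norm_num) hM hw k) (mem_ball_zero_iff.1 hz).le
    rw [norm_smul, Complex.norm_real, Real.norm_eq_abs]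
    calc |m k| * ‖fderiv ℂ (homogPart k f) z‖ ≤ C * 2 ^ k * (M / 4 ^ k) := by
          gcongr
          exact hmC k
      _ = _ := by
          rw [show (4 : ℝ) = 2 * 2 by norm_num, mul_pow, one_div, inv_pow]
          field_simp
  · simp
  · exact hm.summable (differentiable_slice hf z₀)
  · simp

/-- By uniqueness of Taylor coefficients on each line. This is what makes multiplier operators
compose by multiplying their sequences. -/
theorem homogPart_mulOp {n : ℕ} {m : ℕ → ℝ} (hm : SubExp m) {f : Cn n → ℂ}
    (hf : Differentiable ℂ f) (k : ℕ) (z : Cn n) :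
    homogPart k (mulOp m f) z = m k * homogPart k f z := by
  symm
  refine eq_taylorCoeff_of_hasSum (a := fun k => m k * homogPart k f z)
    (differentiable_slice (differentiable_mulOp hm hf) z) (fun t => ?_) k
  have h := (hm.summable (differentiable_slice hf (t • z))).hasSum
  have e : ∀ k, taylorCoeff k (fun s : ℂ => f (s • t • z)) = homogPart k f z * t ^ k := by
    intro k
    symm
    refine eq_taylorCoeff_of_hasSum (a := fun k => homogPart k f z * t ^ k)
      (differentiable_slice hf (t • z)) (fun s => ?_) k
    have := hasSum_homogPart_line hf z (s * t)
    rw [mul_smul] at this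
    convert this using 2 with j
    ring
  simp only [e, ← mul_assoc] at h
  convert h using 2
  simp only [mulOp, homogPart_eq_taylorCoeff, e, mul_assoc]

theorem mulOp_mulOp {n : ℕ} {m : ℕ → ℝ} (m' : ℕ → ℝ) (hm : SubExp m) {f : Cn n → ℂ}
    (hf : Differentiable ℂ f) : mulOp m' (mulOp m f) = mulOp (fun k => m' k * m k) f := by
  funext z
  refine tsum_congr fun k => ?_
  rw [homogPart_mulOp hm hf]
  push_cast
  ring

theorem mulOp_add {n : ℕ} {m : ℕ → ℝ} (hm : SubExp m) {f g : Cn n → ℂ}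
    (hf : Differentiable ℂ f) (hg : Differentiable ℂ g) :
    mulOp m (f + g) = mulOp m f + mulOp m g := by
  funext z
  have h := (hm.summable (differentiable_slice hf z)).tsum_add
    (hm.summable (differentiable_slice hg z))
  simp only [mulOp, Pi.add_apply]
  refine Eq.trans (tsum_congr fun k => ?_) h
  rw [← mul_add, homogPart_eq_taylorCoeff]
  congr 1
  refine (eq_taylorCoeff_of_hasSum (a := fun k => taylorCoeff k (fun t => f (t • z)) +
    taylorCoeff k (fun t => g (t • z))) (differentiable_slice (hf.add hg) z) (fun t => ?_) k).symm
  simp only [add_mul]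
  exact (hasSum_taylorCoeff (differentiable_slice hf z) t).add
    (hasSum_taylorCoeff (differentiable_slice hg z) t)

theorem mulOp_smul {n : ℕ} (m : ℕ → ℝ) (c : ℂ) {f : Cn n → ℂ} (hf : Differentiable ℂ f) :
    mulOp m (c • f) = c • mulOp m f := by
  funext z
  simp only [mulOp, Pi.smul_apply, smul_eq_mul, ← tsum_mul_left]
  refine tsum_congr fun k => ?_
  rw [mul_left_comm, homogPart_eq_taylorCoeff]
  congr 1
  refine (eq_taylorCoeff_of_hasSum (a := fun k => c * taylorCoeff k (fun t => f (t • z)))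
    (differentiable_slice (hf.const_smul c) z) (fun t => ?_) k).symm
  simp only [mul_assoc]
  exact (hasSum_taylorCoeff (differentiable_slice hf z) t).mul_left c

/-! ### Pointwise bounds for multipliers on a complex line -/

/-- A neighbourhood of the segment `[1/4, 1]` of width comparable to `1/q`. -/
def strip (q : ℝ) : Set ℂ := {w | 1 / 4 ≤ w.re ∧ w.re ≤ 1 + 1 / (8 * q) ∧ |w.im| ≤ 1 / (8 * q)}

/-- The multiplier `m` acts with order `d`: `∑ m_k g_k` is controlled by `q^d` times a bound for `g`
near `[1/4, 1]` that decays away from `1`, plus a bound for `g` on the circle `|w| = 1/2`. -/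
def SliceBound (d : ℝ) (m : ℕ → ℝ) : Prop :=
  ∃ C : ℝ, 0 ≤ C ∧ ∀ q : ℝ, 1 ≤ q → ∀ g : ℂ → ℂ, Differentiable ℂ g → ∀ B B' : ℝ, 0 ≤ B → 0 ≤ B' →
    (∀ w ∈ strip q, ‖g w‖ ≤ B * Real.exp (-((1 - w.re) * q / 8))) →
    (∀ w : ℂ, ‖w‖ = 1 / 2 → ‖g w‖ ≤ B') →
    ‖∑' k, (m k : ℂ) * taylorCoeff k g‖ ≤ C * (q ^ d * B + B')

theorem SliceBound.add {d : ℝ} {m m' : ℕ → ℝ} (h : SliceBound d m) (h' : SliceBound d m')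
    (hm : SubExp m) (hm' : SubExp m') : SliceBound d fun k => m k + m' k := by
  obtain ⟨C, hC, H⟩ := h
  obtain ⟨C', hC', H'⟩ := h'
  refine ⟨C + C', by positivity, fun q hq g hg B B' hB hB' h1 h2 => ?_⟩
  have e := (hm.summable hg).tsum_add (hm'.summable hg)
  simp only [Complex.ofReal_add, add_mul]
  rw [e]
  exact (norm_add_le _ _).trans (add_le_add (H q hq g hg B B' hB hB' h1 h2)
    (H' q hq g hg B B' hB hB' h1 h2))

theorem SliceBound.const_mul {d : ℝ} {m : ℕ → ℝ} (h : SliceBound d m) (c : ℝ) :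
    SliceBound d fun k => c * m k := by
  obtain ⟨C, hC, H⟩ := h
  refine ⟨|c| * C, by positivity, fun q hq g hg B B' hB hB' h1 h2 => ?_⟩
  simp only [Complex.ofReal_mul, mul_assoc]
  rw [tsum_mul_left, norm_mul, Complex.norm_real, Real.norm_eq_abs]
  gcongr
  exact H q hq g hg B B' hB hB' h1 h2

/-- Cauchy's estimate on `|w| = 1/2` gives `|g_k| ≤ B' 2^k`, so the terms are at most `C B' 2^{-k}`.
Such a perturbation is harmless for every order `d`. -/
theorem sliceBound_of_geometric (d : ℝ) {m : ℕ → ℝ} {C : ℝ} (hm : ∀ k, |m k| ≤ C * (1 / 4) ^ k) :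
    SliceBound d m := by
  have hC : 0 ≤ C := (abs_nonneg _).trans ((hm 0).trans (by simp))
  refine ⟨2 * C, by positivity, fun q hq g hg B B' hB hB' _ h2 => ?_⟩
  have hs : HasSum (fun k : ℕ => C * B' * (1 / 2 : ℝ) ^ k) (C * B' * 2) :=
    hasSum_geometric_two.mul_left _
  refine (tsum_of_norm_bounded hs fun k => ?_).trans ?_
  · have h3 := norm_taylorCoeff_le hg (by norm_num) h2 k
    rw [norm_mul, Complex.norm_real, Real.norm_eq_abs]
    calc |m k| * ‖taylorCoeff k g‖ ≤ C * (1 / 4) ^ k * (B' / (1 / 2) ^ k) := by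
          gcongr
          exact hm k
      _ = _ := by
          rw [show (1 / 4 : ℝ) = 1 / 2 * (1 / 2) by norm_num, mul_pow]
          field_simp
  · have : 0 ≤ q ^ d * B := by positivity
    nlinarith

theorem hasSum_natCast_mul_taylorCoeff {g : ℂ → ℂ} (hg : Differentiable ℂ g) :
    HasSum (fun k : ℕ => (k : ℂ) * taylorCoeff k g) (deriv g 1) := by
  have h := hasSum_taylorCoeff (hg.deriv) 1
  rw [← hasSum_nat_add_iff' 1]
  simp only [Finset.range_one, Finset.sum_singleton, Nat.cast_zero, zero_mul, sub_zero]
  refine h.congr_fun fun k => ?_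
  simp only [taylorCoeff, ← iteratedDeriv_succ', Nat.factorial_succ]
  have := Nat.factorial_ne_zero k
  have h' : ((k : ℂ) + 1) ≠ 0 := by exact_mod_cast k.succ_ne_zero
  push_cast
  field_simp
  simp

/-- The sum is `g'(1) + c g(1)`. The circle of radius `1/(8q)` about `1` stays in the strip and the
exponential weight is below `3` on it, so Cauchy's estimate gives `|g'(1)| ≤ 24 q B`. -/
theorem sliceBound_natCast_add (c : ℝ) : SliceBound 1 fun k => (k : ℝ) + c := by
  refine ⟨24 + |c|, by positivity, fun q hq g hg B B' hB hB' h1 _ => ?_⟩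
  have hq0 : 0 < q := by linarith
  have hδ : 0 < 1 / (8 * q) := by positivity
  have hδ' : 1 / (8 * q) ≤ 1 / 8 := by
    apply one_div_le_one_div_of_le <;> linarith
  have e1 : ∑' k : ℕ, (((k : ℝ) + c : ℝ) : ℂ) * taylorCoeff k g = deriv g 1 + c * g 1 := by
    have h3 := (hasSum_taylorCoeff hg 1).mul_left (c : ℂ)
    simp only [one_pow, mul_one] at h3
    rw [← ((hasSum_natCast_mul_taylorCoeff hg).add h3).tsum_eq]
    refine tsum_congr fun k => ?_
    push_cast
    ring
  have h4 : ‖deriv g 1‖ ≤ B * 3 / (1 / (8 * q)) := by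
    refine Complex.norm_deriv_le_of_forall_mem_sphere_norm_le hδ hg.diffContOnCl fun w hw => ?_
    have hw' : ‖w - 1‖ = 1 / (8 * q) := by simpa [dist_eq_norm] using hw
    have hre := (Complex.abs_re_le_norm (w - 1)).trans hw'.le
    have him := (Complex.abs_im_le_norm (w - 1)).trans hw'.le
    rw [Complex.sub_re, Complex.one_re, abs_le] at hre
    rw [Complex.sub_im, Complex.one_im, sub_zero] at him
    refine (h1 w ⟨by linarith, by linarith, him⟩).trans ?_
    gcongr
    refine (Real.exp_le_exp.2 ?_).trans Real.exp_one_lt_three.le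
    have h5 : (w.re - 1) * q ≤ 1 / (8 * q) * q := by gcongr; exact hre.2
    have h6 : 1 / (8 * q) * q = 1 / 8 := by field_simp
    linarith
  have h5 : ‖g 1‖ ≤ B := by
    have := h1 1 ⟨by norm_num, by simp [hq0.le], by simp [hq0.le]⟩
    simpa using this
  rw [e1, Real.rpow_one]
  calc ‖deriv g 1 + c * g 1‖ ≤ B * 3 / (1 / (8 * q)) + |c| * B := by
        refine (norm_add_le _ _).trans (add_le_add h4 ?_)
        rw [norm_mul, Complex.norm_real, Real.norm_eq_abs]
        gcongr
    _ = 24 * (q * B) + |c| * B := by field_simp; ring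
    _ ≤ 24 * (q * B + B') + |c| * (q * B + B') := by
        have : B ≤ q * B := le_mul_of_one_le_left hB hq
        gcongr <;> linarith
    _ = _ := by ring

/-! ### Truncated Beta integrals and Gamma quotients -/

theorem rpow_le_rpow_abs {K t : ℝ} (γ : ℝ) (hK : 1 ≤ K) (h1 : K⁻¹ ≤ t) (h2 : t ≤ K) :
    t ^ γ ≤ K ^ |γ| := by
  have hK0 : 0 < K := by linarith
  have ht : 0 < t := (inv_pos.2 hK0).trans_le h1
  rcases le_total 0 γ with h | h
  · rw [abs_of_nonneg h]
    exact Real.rpow_le_rpow ht.le h2 h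
  · rw [abs_of_nonpos h, Real.rpow_neg hK0.le, ← Real.inv_rpow hK0.le]
    exact Real.rpow_le_rpow_of_nonpos (inv_pos.2 hK0) h1 h

/-- The part over `[1/4, 1]` of the Beta integral. -/
def truncBeta (a σ : ℝ) (k : ℕ) : ℝ := ∫ t in (1 / 4 : ℝ)..1, t ^ (a - 1) * (1 - t) ^ (σ - 1) * t ^ k

theorem truncBeta_weight_continuousOn (a : ℝ) {σ : ℝ} (hσ : 1 ≤ σ) :
    ContinuousOn (fun t : ℝ => t ^ (a - 1) * (1 - t) ^ (σ - 1)) (Set.uIcc (1 / 4) 1) := by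
  rw [Set.uIcc_of_le (by norm_num)]
  refine ContinuousOn.mul (ContinuousOn.rpow_const continuousOn_id fun t ht => Or.inl ?_)
    (Continuous.continuousOn (Continuous.rpow_const (by fun_prop) fun t => Or.inr (by linarith)))
  have : (1 / 4 : ℝ) ≤ t := ht.1
  linarith

theorem truncBeta_weight_le (a : ℝ) {σ t : ℝ} (ht : t ∈ Set.Icc (1 / 4 : ℝ) 1) :
    t ^ (a - 1) * (1 - t) ^ (σ - 1) ≤ 4 ^ |a - 1| * (1 - t) ^ (σ - 1) := by
  have h1 := ht.1
  have h2 := ht.2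
  have h3 := rpow_le_rpow_abs (K := 4) (t := t) (a - 1) (by norm_num) (by linarith) (by linarith)
  have h4 : 0 ≤ (1 - t) ^ (σ - 1) := Real.rpow_nonneg (by linarith) _
  gcongr

theorem truncBeta_weight_nonneg (a σ : ℝ) {t : ℝ} (ht : t ∈ Set.Icc (1 / 4 : ℝ) 1) :
    0 ≤ t ^ (a - 1) * (1 - t) ^ (σ - 1) := by
  have h1 := ht.1
  have h2 := ht.2
  exact mul_nonneg (Real.rpow_nonneg (by linarith) _) (Real.rpow_nonneg (by linarith) _)

theorem subExp_truncBeta (a : ℝ) {σ : ℝ} (hσ : 1 ≤ σ) : SubExp (truncBeta a σ) := by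
  refine subExp_of_bounded (C := 4 ^ |a - 1| * |1 - 1 / 4|) fun k => ?_
  rw [← Real.norm_eq_abs, truncBeta]
  refine intervalIntegral.norm_integral_le_of_norm_le_const fun t ht => ?_
  rw [Set.uIoc_of_le (by norm_num)] at ht
  have ht' : t ∈ Set.Icc (1 / 4 : ℝ) 1 := Set.Ioc_subset_Icc_self ht
  have h1 := ht'.1
  have h2 := ht'.2
  have h3 : (1 - t) ^ (σ - 1) ≤ 1 := Real.rpow_le_one (by linarith) (by linarith) (by linarith)
  have h4 : t ^ k ≤ 1 := pow_le_one₀ (by linarith) h2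
  have h5 : (0 : ℝ) ≤ t ^ k := by positivity
  rw [Real.norm_eq_abs, abs_of_nonneg (mul_nonneg (truncBeta_weight_nonneg a σ ht') h5)]
  calc t ^ (a - 1) * (1 - t) ^ (σ - 1) * t ^ k ≤ 4 ^ |a - 1| * (1 - t) ^ (σ - 1) * 1 := by
        gcongr ?_ * ?_
        exact truncBeta_weight_le a ht'
    _ ≤ 4 ^ |a - 1| * 1 * 1 := by gcongr
    _ = _ := by ring

theorem hasSum_truncBeta_mul_taylorCoeff (a : ℝ) {σ : ℝ} (hσ : 1 ≤ σ) {g : ℂ → ℂ}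
    (hg : Differentiable ℂ g) :
    HasSum (fun k => (truncBeta a σ k : ℂ) * taylorCoeff k g)
      (∫ t in (1 / 4 : ℝ)..1, ((t ^ (a - 1) * (1 - t) ^ (σ - 1) : ℝ) : ℂ) * g t) := by
  have hw := truncBeta_weight_continuousOn a hσ
  have hwc : ContinuousOn (fun t : ℝ => ((t ^ (a - 1) * (1 - t) ^ (σ - 1) : ℝ) : ℂ))
      (Set.uIcc (1 / 4) 1) := Complex.continuous_ofReal.comp_continuousOn hw
  have hcoef : Summable fun k => ‖taylorCoeff k g‖ := by
    simpa using (hasSum_taylorCoeff hg 1).summable.norm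
  have key := intervalIntegral.hasSum_integral_of_dominated_convergence (μ := volume)
    (a := (1 / 4 : ℝ)) (b := 1)
    (F := fun (k : ℕ) (t : ℝ) => ((t ^ (a - 1) * (1 - t) ^ (σ - 1) : ℝ) : ℂ) *
      (taylorCoeff k g * (t : ℂ) ^ k))
    (f := fun t : ℝ => ((t ^ (a - 1) * (1 - t) ^ (σ - 1) : ℝ) : ℂ) * g t)
    (fun k t => (t ^ (a - 1) * (1 - t) ^ (σ - 1)) * ‖taylorCoeff k g‖) ?_ ?_ ?_ ?_ ?_
  · refine key.congr_fun fun k => ?_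
    rw [truncBeta, ← intervalIntegral.integral_ofReal, ← intervalIntegral.integral_mul_const]
    refine intervalIntegral.integral_congr fun t _ => ?_
    push_cast
    ring
  · intro k
    refine (ContinuousOn.aestronglyMeasurable ?_ measurableSet_uIoc)
    exact (hwc.mono Set.uIoc_subset_uIcc).mul (by fun_prop)
  · refine fun k => Filter.Eventually.of_forall fun t ht => ?_
    rw [Set.uIoc_of_le (by norm_num)] at ht
    have ht' : t ∈ Set.Icc (1 / 4 : ℝ) 1 := Set.Ioc_subset_Icc_self ht
    have h0 := truncBeta_weight_nonneg a σ ht'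
    have h1 : t ^ k ≤ 1 := pow_le_one₀ (by linarith [ht'.1]) ht'.2
    have h2 : |t| ^ k ≤ 1 := by rwa [abs_of_nonneg (by linarith [ht'.1])]
    rw [norm_mul, norm_mul, norm_pow, Complex.norm_real, Complex.norm_real, Real.norm_eq_abs,
      Real.norm_eq_abs, abs_of_nonneg h0]
    gcongr
    exact mul_le_of_le_one_right (norm_nonneg _) h2
  · exact Filter.Eventually.of_forall fun t _ => hcoef.mul_left _
  · simp only [tsum_mul_left]
    exact (hw.mul continuousOn_const).intervalIntegrable
  · exact Filter.Eventually.of_forall fun t _ => (hasSum_taylorCoeff hg t).mul_left _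

theorem integral_rpow_mul_exp_le {σ r : ℝ} (hσ : 1 ≤ σ) (hr : 0 < r) :
    ∫ t in (1 / 4 : ℝ)..1, (1 - t) ^ (σ - 1) * Real.exp (-(r * (1 - t))) ≤
      (1 / r) ^ σ * Real.Gamma σ := by
  rw [← Real.integral_rpow_mul_exp_neg_mul_Ioi (by linarith) hr,
    intervalIntegral.integral_comp_sub_left (fun u => u ^ (σ - 1) * Real.exp (-(r * u))),
    intervalIntegral.integral_of_le (by norm_num)]
  refine setIntegral_mono_set ?_ ?_ ?_
  -- A non-integrable function would have Bochner integral `0`, whereas the Gamma integral has a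
  -- positive value.
  · by_contra hcon
    have h1 := Real.integral_rpow_mul_exp_neg_mul_Ioi (a := σ) (by linarith) hr
    rw [integral_undef hcon] at h1
    have := Real.Gamma_pos_of_pos (show 0 < σ by linarith)
    have h2 : 0 < (1 / r) ^ σ * Real.Gamma σ := by positivity
    linarith
  · filter_upwards [ae_restrict_mem measurableSet_Ioi] with u hu
    have : 0 < u := hu
    simp only [Pi.zero_apply]
    positivity
  · refine LE.le.eventuallyLE fun u hu => ?_
    have := hu.1
    simp only [Set.mem_Ioi]
    linarith

/-- The sum is the integral of `g` against the Beta weight. The decay of `g` away from `1` at rate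
`q / 8` bounds it by a Gamma integral, equal to `Γ(σ) (8/q)^σ`. -/
theorem sliceBound_truncBeta (a : ℝ) {σ : ℝ} (hσ : 1 ≤ σ) : SliceBound (-σ) (truncBeta a σ) := by
  have hΓ := Real.Gamma_pos_of_pos (show 0 < σ by linarith)
  refine ⟨4 ^ |a - 1| * (8 ^ σ * Real.Gamma σ), by positivity,
    fun q hq g hg B B' hB hB' h1 _ => ?_⟩
  have hq0 : 0 < q := by linarith
  rw [(hasSum_truncBeta_mul_taylorCoeff a hσ hg).tsum_eq]
  have hint : Continuous fun t : ℝ => 4 ^ |a - 1| * B *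
      ((1 - t) ^ (σ - 1) * Real.exp (-(q / 8 * (1 - t)))) :=
    continuous_const.mul ((Continuous.rpow_const (by fun_prop) fun t => Or.inr (by linarith)).mul
      (by fun_prop))
  have h2 := intervalIntegral.norm_integral_le_of_norm_le (μ := volume) (a := (1 / 4 : ℝ)) (b := 1)
    (f := fun t : ℝ => ((t ^ (a - 1) * (1 - t) ^ (σ - 1) : ℝ) : ℂ) * g t)
    (g := fun t => 4 ^ |a - 1| * B * ((1 - t) ^ (σ - 1) * Real.exp (-(q / 8 * (1 - t)))))
    (by norm_num) (Filter.Eventually.of_forall fun t ht => ?_) (hint.intervalIntegrable _ _)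
  · refine h2.trans ?_
    rw [intervalIntegral.integral_const_mul]
    have h3 := integral_rpow_mul_exp_le hσ (show 0 < q / 8 by positivity)
    have h4 : (1 / (q / 8)) ^ σ = 8 ^ σ * q ^ (-σ) := by
      rw [Real.rpow_neg hq0.le, one_div_div, Real.div_rpow (by norm_num) hq0.le, div_eq_mul_inv]
    rw [h4] at h3
    calc _ ≤ 4 ^ |a - 1| * B * (8 ^ σ * q ^ (-σ) * Real.Gamma σ) := by gcongr
      _ = 4 ^ |a - 1| * (8 ^ σ * Real.Gamma σ) * (q ^ (-σ) * B + 0) := by ring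
      _ ≤ _ := by gcongr
  · have ht' : t ∈ Set.Icc (1 / 4 : ℝ) 1 := Set.Ioc_subset_Icc_self ht
    have h3 := h1 t ⟨by simpa using ht'.1, by
      rw [Complex.ofReal_re]
      have : 0 < 1 / (8 * q) := by positivity
      linarith [ht'.2], by simp [hq0.le]⟩
    rw [Complex.ofReal_re] at h3
    have h0 := truncBeta_weight_nonneg a σ ht'
    have h5 := truncBeta_weight_le a (σ := σ) ht'
    rw [norm_mul, Complex.norm_real, Real.norm_eq_abs, abs_of_nonneg h0]
    calc _ ≤ 4 ^ |a - 1| * (1 - t) ^ (σ - 1) * (B * Real.exp (-((1 - t) * q / 8))) :=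
          mul_le_mul h5 h3 (norm_nonneg _) (h0.trans h5)
      _ = _ := by
          rw [show (1 - t) * q / 8 = q / 8 * (1 - t) by ring]
          ring

theorem gamma_mul_gamma_div_gamma {u v : ℝ} (hu : 0 < u) (hv : 0 < v) :
    Real.Gamma u * Real.Gamma v / Real.Gamma (u + v) =
      ∫ t in (0 : ℝ)..1, t ^ (u - 1) * (1 - t) ^ (v - 1) := by
  have h := ProbabilityTheory.beta_eq_betaIntegralReal u v hu hv
  rw [ProbabilityTheory.beta] at h
  rw [h, Complex.betaIntegral, ← Complex.ofReal_re (∫ t in (0 : ℝ)..1, _),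
    ← intervalIntegral.integral_ofReal]
  congr 1
  refine intervalIntegral.integral_congr fun t ht => ?_
  rw [Set.uIcc_of_le zero_le_one] at ht
  rw [Complex.ofReal_mul, Complex.ofReal_cpow ht.1, Complex.ofReal_cpow (by linarith [ht.2])]
  push_cast
  rfl

/-- The difference is the Beta integral over `[0, 1/4]`, where `t^(a+k-1) ≤ (1/4)^(a+k-1)` because
`a + k ≥ 1`. The length of the interval supplies the last factor `1/4`. -/
theorem abs_beta_sub_truncBeta_le {a σ : ℝ} (hσ : 1 ≤ σ) {k : ℕ} (hk : 1 ≤ a + k) :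
    |Real.Gamma (a + k) * Real.Gamma σ / Real.Gamma (a + k + σ) - truncBeta a σ k| ≤
      (1 / 4) ^ a * (1 / 4) ^ k := by
  have hc : Continuous fun t : ℝ => t ^ (a + k - 1) * (1 - t) ^ (σ - 1) :=
    (Continuous.rpow_const (by fun_prop) fun t => Or.inr (by linarith)).mul
      (Continuous.rpow_const (by fun_prop) fun t => Or.inr (by linarith))
  have h1 : truncBeta a σ k = ∫ t in (1 / 4 : ℝ)..1, t ^ (a + k - 1) * (1 - t) ^ (σ - 1) := by
    refine intervalIntegral.integral_congr fun t ht => ?_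
    rw [Set.uIcc_of_le (by norm_num)] at ht
    have ht0 : 0 < t := by linarith [ht.1]
    rw [show a + k - 1 = a - 1 + k by ring, Real.rpow_add_natCast ht0.ne']
    ring
  rw [gamma_mul_gamma_div_gamma (by linarith) (by linarith), h1,
    ← intervalIntegral.integral_add_adjacent_intervals (b := 1 / 4) (hc.intervalIntegrable _ _)
      (hc.intervalIntegrable _ _), add_sub_cancel_right]
  have h2 := intervalIntegral.norm_integral_le_of_norm_le_const (a := (0 : ℝ)) (b := 1 / 4)
    (f := fun t : ℝ => t ^ (a + k - 1) * (1 - t) ^ (σ - 1)) (C := (1 / 4) ^ (a + k - 1))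
    fun t ht => by
      rw [Set.uIoc_of_le (by norm_num)] at ht
      have ht0 : 0 ≤ t := ht.1.le
      have ht1 : 0 ≤ 1 - t := by linarith [ht.2]
      rw [Real.norm_eq_abs, abs_of_nonneg (by positivity)]
      calc t ^ (a + k - 1) * (1 - t) ^ (σ - 1) ≤ (1 / 4) ^ (a + k - 1) * 1 := by
            refine mul_le_mul (Real.rpow_le_rpow ht0 ht.2 (by linarith))
              (Real.rpow_le_one ht1 (by linarith) (by linarith)) (by positivity) (by positivity)
        _ = _ := mul_one _
  refine h2.trans (le_of_eq ?_)
  rw [show a + k - 1 = a - 1 + k by ring, Real.rpow_add_natCast (by norm_num),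
    Real.rpow_sub_one (by norm_num)]
  norm_num
  ring

/-- The multipliers `Γ(a+k)/Γ(a+σ+k)`, with finitely many entries replaced by `0`. -/
theorem sliceBound_gammaRatio {a σ : ℝ} (hσ : 1 ≤ σ) (S : ℕ → Prop) [DecidablePred S]
    (hS : ∃ K, ∀ k, K ≤ k → S k) :
    let m : ℕ → ℝ := fun k => if S k then Real.Gamma (a + k) / Real.Gamma (a + σ + k) else 0
    SubExp m ∧ SliceBound (-σ) m := by
  intro m
  have hΓ := Real.Gamma_pos_of_pos (show 0 < σ by linarith)
  set e : ℕ → ℝ := fun k => Real.Gamma σ * m k - truncBeta a σ k with he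
  obtain ⟨K, hK⟩ := hS
  obtain ⟨K', hK'⟩ := exists_nat_ge (1 - a)
  have hO : e =O[Filter.atTop] fun k : ℕ => (1 / 4 : ℝ) ^ k := by
    refine Asymptotics.IsBigO.of_bound ((1 / 4) ^ a) ?_
    filter_upwards [Filter.eventually_ge_atTop (max K K')] with k hk
    have h1 : S k := hK k (le_of_max_le_left hk)
    have h2 : (K' : ℝ) ≤ k := by exact_mod_cast le_of_max_le_right hk
    have h3 := abs_beta_sub_truncBeta_le hσ (a := a) (k := k) (by linarith)
    rw [Real.norm_eq_abs, Real.norm_eq_abs, abs_of_pos (show 0 < (1 / 4 : ℝ) ^ k by positivity)]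
    convert h3 using 2
    simp only [e, m, if_pos h1]
    rw [show a + σ + k = a + k + σ by ring]
    ring
  -- Since `(1/4)^k` never vanishes, the eventual bound becomes one for all `k`. This absorbs the
  -- entries replaced by `0` and the small `k` for which `a + k` may fail to be positive.
  obtain ⟨C, hC, hb⟩ := Asymptotics.bound_of_isBigO_nat_atTop hO
  have hb' : ∀ k, |e k| ≤ C * (1 / 4) ^ k := fun k => by
    have h0 : 0 < (1 / 4 : ℝ) ^ k := by positivity
    have := hb h0.ne'
    rwa [Real.norm_eq_abs, Real.norm_eq_abs, abs_of_pos h0] at this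
  have hbe : SubExp e := subExp_of_bounded (C := C) fun k => (hb' k).trans
    (mul_le_of_le_one_right hC.le (pow_le_one₀ (by norm_num) (by norm_num)))
  have hm : m = fun k => (Real.Gamma σ)⁻¹ * (truncBeta a σ k + e k) := by
    funext k
    simp only [he]
    field_simp
    ring
  have hsum : SubExp fun k => truncBeta a σ k + e k := by
    intro r hr
    obtain ⟨C1, h1, h1'⟩ := subExp_truncBeta a hσ r hr
    obtain ⟨C2, h2, h2'⟩ := hbe r hr
    refine ⟨C1 + C2, by positivity, fun k => (abs_add_le _ _).trans ?_⟩
    rw [add_mul]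
    exact add_le_add (h1' k) (h2' k)
  rw [hm]
  exact ⟨(subExp_of_bounded fun _ => le_rfl).mul hsum, ((sliceBound_truncBeta a hσ).add
    (sliceBound_of_geometric _ hb') (subExp_truncBeta a hσ) hbe).const_mul _⟩

/-! ### Integration along complex lines -/

instance isAddHaarMeasure_dV (n : ℕ) : (dV n).IsAddHaarMeasure := by
  have h : (Measure.map (WithLp.toLp 2) (volume : Measure (Fin n → ℂ))).IsAddHaarMeasure :=
    (PiLp.continuousLinearEquiv 2 ℝ (fun _ : Fin n => ℂ)).symm.isAddHaarMeasure_map volume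
  exact Measure.IsAddHaarMeasure.smul _ (by simp; positivity) ENNReal.ofReal_ne_top

/-- Multiplication by `w` on `ℂⁿ` has real determinant `|w|^(2n)`. -/
theorem lintegral_comp_smul {n : ℕ} {w : ℂ} (hw : w ≠ 0) {F : Cn n → ℝ≥0∞} (hF : Measurable F) :
    ∫⁻ z, F (w • z) ∂dV n = ENNReal.ofReal ((‖w‖ ^ (2 * n))⁻¹) * ∫⁻ z, F z ∂dV n := by
  set L : Cn n →ₗ[ℝ] Cn n := (w • LinearMap.id : Cn n →ₗ[ℂ] Cn n).restrictScalars ℝ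
  have hdet : LinearMap.det L = ‖w‖ ^ (2 * n) := by
    rw [LinearMap.det_restrictScalars, LinearMap.det_smul, LinearMap.det_id, mul_one, map_pow,
      Algebra.norm_complex_apply, Complex.normSq_eq_norm_sq, ← pow_mul]
    simp
  have hpos : 0 < ‖w‖ ^ (2 * n) := by positivity
  have h := Measure.map_linearMap_addHaar_eq_smul_addHaar (dV n) (f := L)
    (by rw [hdet]; exact hpos.ne')
  rw [hdet, abs_of_pos (inv_pos.2 hpos)] at h
  have h2 := lintegral_map (μ := dV n) hF (show Measurable L from
    (continuous_const_smul w).measurable)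
  rw [h, lintegral_smul_measure] at h2
  exact h2.symm

/-- A Schur-type test: Tonelli, the substitution `z ↦ z/w` for fixed `w`, and Tonelli again leave `F
z` times the integral in `h` at `r = |z|`. The vanishing of `κ` at `w = 0` removes the one point
where the substitution fails. -/
theorem lintegral_lintegral_slice_le {n : ℕ} {κ : ℂ → ℝ → ℝ≥0∞}
    (hκ : Measurable (Function.uncurry κ)) (hκ0 : ∀ ρ, κ 0 ρ = 0) {ω : ℝ → ℝ≥0∞} {C : ℝ≥0∞}
    (hC : C ≠ ∞)
    (h : ∀ r : ℝ, 0 ≤ r →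
      ∫⁻ w, ENNReal.ofReal ((‖w‖ ^ (2 * n))⁻¹) * κ w (r / ‖w‖) ≤ C * ω r)
    {F : Cn n → ℝ≥0∞} (hF : Measurable F) :
    ∫⁻ z, (∫⁻ w : ℂ, F (w • z) * κ w ‖z‖) ∂dV n ≤ C * ∫⁻ z, F z * ω ‖z‖ ∂dV n := by
  rw [lintegral_lintegral_swap]
  swap
  · refine Measurable.aemeasurable ?_
    exact (hF.comp (measurable_snd.smul measurable_fst)).mul
      (hκ.comp (measurable_snd.prodMk measurable_fst.norm))
  calc ∫⁻ w : ℂ, ∫⁻ z, F (w • z) * κ w ‖z‖ ∂dV n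
      = ∫⁻ w : ℂ, ∫⁻ z, ENNReal.ofReal ((‖w‖ ^ (2 * n))⁻¹) * (F z * κ w (‖z‖ / ‖w‖)) ∂dV n := by
        refine lintegral_congr fun w => ?_
        rcases eq_or_ne w 0 with rfl | hw
        · simp [hκ0]
        · have hm : Measurable fun z : Cn n => F z * κ w (‖z‖ / ‖w‖) :=
            hF.mul (hκ.comp (measurable_const.prodMk (measurable_norm.div_const _)))
          rw [lintegral_const_mul _ hm, ← lintegral_comp_smul hw hm]
          refine lintegral_congr fun z => ?_
          rw [norm_smul, mul_div_cancel_left₀ _ (norm_ne_zero_iff.2 hw)]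
    _ = ∫⁻ z, (F z * ∫⁻ w : ℂ, ENNReal.ofReal ((‖w‖ ^ (2 * n))⁻¹) * κ w (‖z‖ / ‖w‖)) ∂dV n := by
        have hm1 : Measurable fun q : ℂ × Cn n => κ q.1 (‖q.2‖ / ‖q.1‖) :=
          hκ.comp (measurable_fst.prodMk (measurable_snd.norm.div measurable_fst.norm))
        have hm2 : Measurable fun q : ℂ × Cn n => ENNReal.ofReal ((‖q.1‖ ^ (2 * n))⁻¹) := by
          fun_prop
        rw [lintegral_lintegral_swap]
        · refine lintegral_congr fun z => ?_
          have hm3 : Measurable fun w : ℂ =>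
              ENNReal.ofReal ((‖w‖ ^ (2 * n))⁻¹) * κ w (‖z‖ / ‖w‖) :=
            (hm2.mul hm1).comp (measurable_id.prodMk (measurable_const (a := z)))
          rw [← lintegral_const_mul _ hm3]
          exact lintegral_congr fun w => mul_left_comm _ _ _
        · exact (hm2.mul ((hF.comp measurable_snd).mul hm1)).aemeasurable
    _ ≤ ∫⁻ z, C * (F z * ω ‖z‖) ∂dV n := by
        refine lintegral_mono fun z => ?_
        calc _ ≤ F z * (C * ω ‖z‖) := by gcongr; exact h _ (norm_nonneg _)
          _ = _ := mul_left_comm _ _ _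
    _ = _ := lintegral_const_mul' _ _ hC

/-! ### Kernels on a complex line and their integrals -/

/-- An open neighbourhood of `strip q`. -/
def wideStrip (q : ℝ) : Set ℂ :=
  {w | 1 / 8 < w.re ∧ w.re < 1 + 1 / (4 * q) ∧ |w.im| < 1 / (4 * q)}

open Classical in
/-- The weight of `|g|^p` near the segment `[1/4, 1]`. -/
def bulkKernel (p : ℝ) (w : ℂ) (ρ : ℝ) : ℝ≥0∞ :=
  if w ∈ wideStrip ((1 + ρ) ^ 2) then
    ENNReal.ofReal (Real.exp (-(p * (‖w‖ ^ 2 * ρ ^ 2 / 2 + (1 - w.re) * (1 + ρ) ^ 2 / 8)))) else 0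

open Classical in
/-- The indicator of the annulus `1/4 < |w| < 3/4`. -/
def annulusKernel (w : ℂ) : ℝ≥0∞ := if 1 / 4 < ‖w‖ ∧ ‖w‖ < 3 / 4 then 1 else 0

theorem measurable_bulkKernel (p : ℝ) : Measurable (Function.uncurry (bulkKernel p)) := by
  have hre : Measurable fun q : ℂ × ℝ => q.1.re := Complex.measurable_re.comp measurable_fst
  have him : Measurable fun q : ℂ × ℝ => |q.1.im| :=
    (Complex.measurable_im.comp measurable_fst).abs
  have hq : Measurable fun q : ℂ × ℝ => 1 / (4 * (1 + q.2) ^ 2) := by fun_prop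
  refine Measurable.ite (p := fun q : ℂ × ℝ => q.1 ∈ wideStrip ((1 + q.2) ^ 2)) ?_ ?_
    measurable_const
  · exact (measurableSet_lt measurable_const hre).inter
      ((measurableSet_lt hre (measurable_const.add hq)).inter (measurableSet_lt him hq))
  · fun_prop

theorem measurable_annulusKernel : Measurable annulusKernel := by
  refine Measurable.ite ?_ measurable_const measurable_const
  exact (measurableSet_lt measurable_const measurable_norm).inter
    (measurableSet_lt measurable_norm measurable_const)

theorem norm_mem_of_mem_wideStrip {q : ℝ} (hq : 1 ≤ q) {w : ℂ} (hw : w ∈ wideStrip q) :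
    1 / 8 < ‖w‖ ∧ ‖w‖ < 2 := by
  obtain ⟨h1, h2, h3⟩ := hw
  have h4 : 1 / (4 * q) ≤ 1 / 4 := one_div_le_one_div_of_le (by norm_num) (by linarith)
  refine ⟨h1.trans_le (Complex.re_le_norm w), (Complex.norm_le_abs_re_add_abs_im w).trans_lt ?_⟩
  rw [abs_of_pos (by linarith)]
  linarith

theorem one_add_div_rpow_le {r u : ℝ} (hr : 0 ≤ r) (h1 : 1 / 8 ≤ u) (h2 : u ≤ 8) (γ : ℝ) :
    (1 + r / u) ^ γ ≤ 8 ^ |γ| * (1 + r) ^ γ := by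
  have hu : 0 < u := by linarith
  have h3 := rpow_le_rpow_abs (K := 8) (t := (1 + r / u) / (1 + r)) γ (by norm_num)
    (by
      rw [inv_eq_one_div, div_le_div_iff₀ (by norm_num) (by linarith)]
      have : r / 8 ≤ r / u := by gcongr
      linarith)
    (by
      rw [div_le_iff₀ (by linarith)]
      have : r / u ≤ r / (1 / 8) := by gcongr
      linarith)
  rwa [Real.div_rpow (by positivity) (by positivity), div_le_iff₀ (by positivity)] at h3

theorem lintegral_re_im (φ ψ : ℝ → ℝ≥0∞) (hφ : Measurable φ) (hψ : Measurable ψ) :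
    ∫⁻ w : ℂ, φ w.re * ψ w.im = (∫⁻ x, φ x) * ∫⁻ y, ψ y := by
  rw [← lintegral_prod_mul hφ.aemeasurable hψ.aemeasurable, ← Measure.volume_eq_prod]
  exact Complex.volume_preserving_equiv_real_prod.lintegral_comp
    ((hφ.comp measurable_fst).mul (hψ.comp measurable_snd))

/-- With `ρ = r/|w|` the Gaussian exponent `|w|²ρ²` equals `r²` and no longer depends on `w`. As
`|w| < 2`, the scale `(1+ρ)^2` is at least a quarter of `(1+r)^2`, so what remains is dominated by a
function of `Re w` times one of `Im w`. -/
theorem bulkKernel_scaled_le {p : ℝ} (hp : 0 < p) {r : ℝ} (hr : 0 ≤ r) (w : ℂ) :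
    bulkKernel p w (r / ‖w‖) ≤ ENNReal.ofReal (Real.exp (-(p * r ^ 2 / 2)) * Real.exp (p / 32)) *
      ((Set.Iic (1 + 1 / (1 + r) ^ 2)).indicator
        (fun x => ENNReal.ofReal (Real.exp (p / 32 * (1 + r) ^ 2 * (x - 1)))) w.re *
      (Set.Icc (-(1 / (1 + r) ^ 2)) (1 / (1 + r) ^ 2)).indicator 1 w.im) := by
  rw [bulkKernel]
  split_ifs with hw
  swap; · simp
  have hq1 : 1 ≤ (1 + r / ‖w‖) ^ 2 := one_le_pow₀ (by linarith [show 0 ≤ r / ‖w‖ by positivity])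
  obtain ⟨hn1, hn2⟩ := norm_mem_of_mem_wideStrip hq1 hw
  obtain ⟨h1, h2, h3⟩ := hw
  have hn0 : 0 < ‖w‖ := by linarith
  have hQ : (1 + r) ^ 2 / 4 ≤ (1 + r / ‖w‖) ^ 2 := by
    have h4 : r / 2 ≤ r / ‖w‖ := by gcongr
    nlinarith
  have hQ0 : 0 < (1 + r) ^ 2 := by positivity
  set q := (1 + r / ‖w‖) ^ 2
  set Q := (1 + r) ^ 2
  have hq0 : 0 < q := by linarith
  have hqQ : 1 / (4 * q) ≤ 1 / Q := one_div_le_one_div_of_le hQ0 (by linarith)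
  have him := abs_le.1 (h3.le.trans hqQ)
  rw [Set.indicator_of_mem (show w.re ∈ Set.Iic (1 + 1 / Q) from by
      simp only [Set.mem_Iic]; linarith),
    Set.indicator_of_mem (show w.im ∈ Set.Icc (-(1 / Q)) (1 / Q) from him), Pi.one_apply, mul_one,
    ← ENNReal.ofReal_mul (by positivity), ← Real.exp_add, ← Real.exp_add]
  refine ENNReal.ofReal_le_ofReal (Real.exp_le_exp.2 ?_)
  have e1 : ‖w‖ ^ 2 * (r / ‖w‖) ^ 2 = r ^ 2 := by field_simp
  rw [e1]
  -- To the right of `1` the exponential grows, but `Re w - 1 < 1/(4q)`. The resulting `1/4`,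
  -- multiplied by `p / 8`, is the source of `exp (p / 32)`.
  have key : (1 - w.re) * Q / 4 ≤ (1 - w.re) * q + 1 / 4 := by
    rcases le_total w.re 1 with h | h
    · nlinarith
    · have h5 : (w.re - 1) * q ≤ 1 / (4 * q) * q := by
        gcongr
        linarith
      have h6 : 1 / (4 * q) * q = 1 / 4 := by field_simp
      nlinarith
  nlinarith

/-- The integrals in `Re w` and `Im w` each contribute a constant times `(1+r)^(-2)`. Together they
cancel the power `4`, which is the price of the sub-mean value property on discs of radius
comparable to `(1+r)^(-2)`. -/
theorem lintegral_bulkKernel_le {p : ℝ} (hp : 0 < p) (n : ℕ) (β : ℝ) :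
    ∃ C : ℝ, 0 ≤ C ∧ ∀ r : ℝ, 0 ≤ r →
      ∫⁻ w : ℂ, ENNReal.ofReal ((‖w‖ ^ (2 * n))⁻¹) *
        (ENNReal.ofReal ((1 + r / ‖w‖) ^ (4 - β)) * bulkKernel p w (r / ‖w‖)) ≤
      ENNReal.ofReal C * ENNReal.ofReal (Real.exp (-(p * r ^ 2 / 2)) * (1 + r) ^ (-β)) := by
  refine ⟨8 ^ (2 * n) * 8 ^ |4 - β| * Real.exp (p / 32) * (Real.exp (p / 32) * 32 / p) * 2,
    by positivity, fun r hr => ?_⟩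
  set Q := (1 + r) ^ 2 with hQ
  have hQ0 : 0 < Q := by positivity
  set φ : ℝ → ℝ≥0∞ := (Set.Iic (1 + 1 / Q)).indicator
    fun x => ENNReal.ofReal (Real.exp (p / 32 * Q * (x - 1))) with hφdef
  set ψ : ℝ → ℝ≥0∞ := (Set.Icc (-(1 / Q)) (1 / Q)).indicator 1 with hψdef
  have hφ : Measurable φ := Measurable.indicator (by fun_prop) measurableSet_Iic
  have hψ : Measurable ψ := measurable_one.indicator measurableSet_Icc
  have hφi : ∫⁻ x, φ x = ENNReal.ofReal (Real.exp (p / 32) * 32 / p / Q) := by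
    have ha : 0 < p / 32 * Q := by positivity
    have e : ∀ x, Real.exp (p / 32 * Q * (x - 1)) =
        Real.exp (-(p / 32 * Q)) * Real.exp (p / 32 * Q * x) := fun x => by
      rw [← Real.exp_add]; ring_nf
    rw [hφdef, lintegral_indicator measurableSet_Iic]
    simp only [e]
    rw [← ofReal_integral_eq_lintegral_ofReal ((integrableOn_exp_mul_Iic ha _).const_mul _)
      (Filter.Eventually.of_forall fun x => by positivity), integral_const_mul,
      integral_exp_mul_Iic ha, mul_div_assoc', ← Real.exp_add]
    congr 1
    rw [show -(p / 32 * Q) + p / 32 * Q * (1 + 1 / Q) = p / 32 by field_simp; ring]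
    field_simp
  have hψi : ∫⁻ y, ψ y = ENNReal.ofReal (2 / Q) := by
    rw [hψdef, lintegral_indicator_one measurableSet_Icc, Real.volume_Icc]
    congr 1; ring
  calc _ ≤ ∫⁻ w : ℂ, ENNReal.ofReal (8 ^ (2 * n) * (8 ^ |4 - β| * (1 + r) ^ (4 - β)) *
        (Real.exp (-(p * r ^ 2 / 2)) * Real.exp (p / 32))) * (φ w.re * ψ w.im) := by
        refine lintegral_mono fun w => ?_
        by_cases hw : w ∈ wideStrip ((1 + r / ‖w‖) ^ 2)
        · have hq1 : 1 ≤ (1 + r / ‖w‖) ^ 2 :=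
            one_le_pow₀ (by linarith [show 0 ≤ r / ‖w‖ by positivity])
          obtain ⟨hn1, hn2⟩ := norm_mem_of_mem_wideStrip hq1 hw
          have h3 : (‖w‖ ^ (2 * n))⁻¹ ≤ 8 ^ (2 * n) := by
            rw [← inv_pow]
            gcongr
            rw [inv_le_comm₀ (by linarith) (by norm_num)]
            linarith
          have h4 := one_add_div_rpow_le hr hn1.le (by linarith) (4 - β)
          rw [← mul_assoc, ← ENNReal.ofReal_mul (by positivity),
            ENNReal.ofReal_mul (p := 8 ^ (2 * n) * (8 ^ |4 - β| * (1 + r) ^ (4 - β))) (by positivity),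
            mul_assoc]
          gcongr
          exact bulkKernel_scaled_le hp hr w
        · rw [bulkKernel, if_neg hw]
          simp
    _ = _ := by
        rw [lintegral_const_mul' _ _ ENNReal.ofReal_ne_top, lintegral_re_im φ ψ hφ hψ, hφi, hψi,
          ← ENNReal.ofReal_mul (by positivity), ← ENNReal.ofReal_mul (by positivity),
          ← ENNReal.ofReal_mul (by positivity)]
        congr 1
        have e : (1 + r) ^ (4 - β) = Q ^ 2 * (1 + r) ^ (-β) := by
          rw [sub_eq_add_neg, Real.rpow_add (by positivity), hQ, ← pow_mul]
          norm_cast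
        rw [e]
        field_simp

/-- Since `1 + r ≤ e^r`, it suffices that `r|M| ≤ c r² + M²/(4c)`, which is a completed square. -/
theorem one_add_rpow_le_exp (M : ℝ) {c : ℝ} (hc : 0 < c) :
    ∃ C : ℝ, 0 ≤ C ∧ ∀ r : ℝ, 0 ≤ r → (1 + r) ^ M ≤ C * Real.exp (c * r ^ 2) := by
  refine ⟨Real.exp (M ^ 2 / (4 * c)), by positivity, fun r hr => ?_⟩
  calc (1 + r) ^ M ≤ (1 + r) ^ |M| :=
        Real.rpow_le_rpow_of_exponent_le (by linarith) (le_abs_self M)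
    _ ≤ Real.exp r ^ |M| := by
        gcongr
        linarith [Real.add_one_le_exp r]
    _ = Real.exp (r * |M|) := by rw [← Real.exp_mul]
    _ ≤ _ := by
        rw [← Real.exp_add]
        gcongr
        have h1 : M ^ 2 / (4 * c) + c * r ^ 2 - r * |M| = (2 * c * r - |M|) ^ 2 / (4 * c) := by
          rw [← sq_abs M]
          field_simp
          ring
        have h2 : 0 ≤ (2 * c * r - |M|) ^ 2 / (4 * c) := by positivity
        linarith

/-- For `|w| < 3/4` one has `(r/|w|)² ≥ (3/2) r²`. The spare factor `e^{-p r²/4}` absorbs every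
power of `1 + r`, so the exponents `β` and `γ` are unrelated. -/
theorem lintegral_annulusKernel_le {p : ℝ} (hp : 0 < p) (n : ℕ) (β γ : ℝ) :
    ∃ C : ℝ, 0 ≤ C ∧ ∀ r : ℝ, 0 ≤ r →
      ∫⁻ w : ℂ, ENNReal.ofReal ((‖w‖ ^ (2 * n))⁻¹) *
        (ENNReal.ofReal (Real.exp (-(p * (r / ‖w‖) ^ 2 / 2)) * (1 + r / ‖w‖) ^ γ) *
          annulusKernel w) ≤
      ENNReal.ofReal C * ENNReal.ofReal (Real.exp (-(p * r ^ 2 / 2)) * (1 + r) ^ (-β)) := by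
  obtain ⟨K, hK, hKr⟩ := one_add_rpow_le_exp (γ + β) (show 0 < p / 4 by positivity)
  refine ⟨4 ^ (2 * n) * (8 ^ |γ| * K) * (3 / 4) ^ 2 * Real.pi, by positivity, fun r hr => ?_⟩
  have hpt : ∀ w : ℂ, 1 / 4 < ‖w‖ → ‖w‖ < 3 / 4 →
      (‖w‖ ^ (2 * n))⁻¹ * (Real.exp (-(p * (r / ‖w‖) ^ 2 / 2)) * (1 + r / ‖w‖) ^ γ) ≤
        4 ^ (2 * n) * (8 ^ |γ| * K) * (Real.exp (-(p * r ^ 2 / 2)) * (1 + r) ^ (-β)) := by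
    intro w hw1 hw2
    have hw0 : 0 < ‖w‖ := by linarith
    have h3 : (‖w‖ ^ (2 * n))⁻¹ ≤ 4 ^ (2 * n) := by
      rw [← inv_pow]
      gcongr
      rw [inv_le_comm₀ (by linarith) (by norm_num)]
      linarith
    have h4 := one_add_div_rpow_le hr (by linarith : 1 / 8 ≤ ‖w‖) (by linarith) γ
    have h5 : r ^ 2 * (3 / 2) ≤ (r / ‖w‖) ^ 2 := by
      rw [div_pow, le_div_iff₀ (by positivity)]
      have : ‖w‖ ^ 2 ≤ (3 / 4) ^ 2 := by gcongr
      nlinarith [sq_nonneg r]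
    have h6 : (1 + r) ^ γ ≤ K * Real.exp (p / 4 * r ^ 2) * (1 + r) ^ (-β) := by
      have := hKr r hr
      have e : (1 + r) ^ γ = (1 + r) ^ (γ + β) * (1 + r) ^ (-β) := by
        rw [← Real.rpow_add (by positivity)]; ring_nf
      rw [e]
      gcongr
    have h7 : Real.exp (-(p * (r / ‖w‖) ^ 2 / 2)) ≤
        Real.exp (-(p * r ^ 2 / 2)) * Real.exp (-(p / 4 * r ^ 2)) := by
      rw [← Real.exp_add]
      gcongr
      nlinarith
    calc _ ≤ 4 ^ (2 * n) * ((Real.exp (-(p * r ^ 2 / 2)) * Real.exp (-(p / 4 * r ^ 2))) *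
          (8 ^ |γ| * (K * Real.exp (p / 4 * r ^ 2) * (1 + r) ^ (-β)))) := by
          gcongr
          exact h4.trans (by gcongr)
      _ = 4 ^ (2 * n) * (8 ^ |γ| * K) * (Real.exp (-(p * r ^ 2 / 2)) * (1 + r) ^ (-β)) *
          (Real.exp (-(p / 4 * r ^ 2)) * Real.exp (p / 4 * r ^ 2)) := by ring
      _ = _ := by rw [← Real.exp_add]; simp
  set D := 4 ^ (2 * n) * (8 ^ |γ| * K) * (Real.exp (-(p * r ^ 2 / 2)) * (1 + r) ^ (-β)) with hD
  calc _ ≤ ∫⁻ w : ℂ, (Metric.ball (0 : ℂ) (3 / 4)).indicator (fun _ => ENNReal.ofReal D) w := by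
        refine lintegral_mono fun w => ?_
        by_cases hw : 1 / 4 < ‖w‖ ∧ ‖w‖ < 3 / 4
        · rw [annulusKernel, if_pos hw, mul_one, ← ENNReal.ofReal_mul (by positivity),
            Set.indicator_of_mem (by simpa using hw.2)]
          exact ENNReal.ofReal_le_ofReal (hpt w hw.1 hw.2)
        · rw [annulusKernel, if_neg hw]
          simp
    _ = _ := by
        rw [lintegral_indicator_const measurableSet_ball, Complex.volume_ball,
          ← ENNReal.ofReal_pow (by norm_num), show (NNReal.pi : ℝ≥0∞) = ENNReal.ofReal Real.pi by
            rw [← NNReal.coe_real_pi, ENNReal.ofReal_coe_nnreal],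
          ← ENNReal.ofReal_mul (by positivity), ← ENNReal.ofReal_mul (by positivity),
          ← ENNReal.ofReal_mul (by positivity)]
        congr 1
        rw [hD]
        ring

/-! ### Boundedness of multipliers between weighted Fock spaces -/

/-- On the segment `1 - t² ≥ 1 - t`, and `(1+ρ)² ≤ 2 + 2ρ²` turns `ρ²` into the scale `(1+ρ)²`. The
constant `2` absorbs this exchange, the imaginary part and the overshoot beyond `Re w = 1`. -/
theorem gaussian_exponent_le {ρ : ℝ} (hρ : 0 ≤ ρ) {w : ℂ} (hw : w ∈ wideStrip ((1 + ρ) ^ 2)) :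
    ‖w‖ ^ 2 * ρ ^ 2 / 2 ≤ ρ ^ 2 / 2 + 2 - (1 - w.re) * (1 + ρ) ^ 2 / 4 := by
  obtain ⟨h1, h2, h3⟩ := hw
  have hq1 : 1 ≤ (1 + ρ) ^ 2 := one_le_pow₀ (by linarith)
  have hq2 : (1 + ρ) ^ 2 ≤ 2 + 2 * ρ ^ 2 := by nlinarith [sq_nonneg (1 - ρ)]
  have hρq : ρ ^ 2 ≤ (1 + ρ) ^ 2 := by nlinarith
  set q := (1 + ρ) ^ 2
  have hq0 : 0 < q := by linarith
  have h4 : 1 / (4 * q) * q = 1 / 4 := by field_simp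
  have h5 : 1 / (4 * q) ≤ 1 / 4 := one_div_le_one_div_of_le (by norm_num) (by linarith)
  have h6 : w.im ^ 2 * ρ ^ 2 ≤ 1 / 4 := by
    have h7 : w.im ^ 2 ≤ (1 / (4 * q)) ^ 2 := by
      rw [← sq_abs w.im]
      gcongr
    have h8 : (0 : ℝ) < 1 / (4 * q) := by positivity
    calc w.im ^ 2 * ρ ^ 2 ≤ (1 / (4 * q)) ^ 2 * q := by gcongr
      _ = 1 / (4 * q) * (1 / (4 * q) * q) := by ring
      _ ≤ 1 / 4 * 1 := by rw [h4]; nlinarith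
      _ = _ := by ring
  rw [Complex.sq_norm, Complex.normSq_apply]
  rcases le_total w.re 1 with h | h
  · have h9 : (1 - w.re) * q ≤ (1 - w.re) * (2 + 2 * ρ ^ 2) := by gcongr
    have h10 : 0 ≤ w.re * (1 - w.re) * ρ ^ 2 :=
      mul_nonneg (mul_nonneg (by linarith) (by linarith)) (sq_nonneg _)
    nlinarith
  · have h9 : (w.re - 1) * q ≤ 1 / 4 := by
      rw [← h4]
      gcongr
      linarith
    have h10 : (w.re - 1) * ρ ^ 2 ≤ 1 / 4 := le_trans (by gcongr) h9
    have h11 : (w.re - 1) * ρ ^ 2 * (w.re + 1) ≤ 1 / 4 * (9 / 4) := by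
      gcongr
      linarith
    nlinarith

theorem ball_subset_wideStrip {q : ℝ} (hq : 1 ≤ q) {w : ℂ} (hw : w ∈ strip q) :
    Metric.ball w (1 / (8 * q)) ⊆ wideStrip q := by
  intro u hu
  obtain ⟨h1, h2, h3⟩ := hw
  have hu' : ‖u - w‖ < 1 / (8 * q) := by simpa [dist_eq_norm] using hu
  have hre := abs_lt.1 ((Complex.abs_re_le_norm (u - w)).trans_lt hu')
  have him := abs_lt.1 ((Complex.abs_im_le_norm (u - w)).trans_lt hu')
  rw [Complex.sub_re] at hre
  rw [Complex.sub_im] at him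
  have h4 : 1 / (8 * q) ≤ 1 / 8 := one_div_le_one_div_of_le (by norm_num) (by linarith)
  have h5 : 1 / (4 * q) = 1 / (8 * q) + 1 / (8 * q) := by field_simp; norm_num
  have h6 := abs_le.1 h3
  refine ⟨by linarith, by linarith, abs_lt.2 ⟨by linarith, by linarith⟩⟩

/-- The decay rate `q / 4` from `gaussian_exponent_le`, `q = (1+ρ)^2`, is split in two. One `q / 8`
becomes the pointwise decay in `w` that `SliceBound` asks for, the other stays in `bulkKernel` to
make it integrable. -/
theorem rpow_enorm_le_on_strip {p : ℝ} (hp : 0 < p) :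
    ∃ C : ℝ, 0 < C ∧ ∀ ρ : ℝ, 0 ≤ ρ → ∀ g : ℂ → ℂ, Differentiable ℂ g →
      ∀ w ∈ strip ((1 + ρ) ^ 2), ‖g w‖ₑ ^ p ≤
        ENNReal.ofReal (C * (1 + ρ) ^ 4 *
          Real.exp (p * (ρ ^ 2 / 2 - (1 - w.re) * (1 + ρ) ^ 2 / 8))) *
        ∫⁻ u, ‖g u‖ₑ ^ p * bulkKernel p u ρ := by
  obtain ⟨C, hC, H⟩ := exists_rpow_enorm_le_lintegral_ball hp
  -- The factor `64 * (1 + ρ) ^ 4` is the inverse square of the radius `1 / (8 * (1 + ρ) ^ 2)`; the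
  -- `3` is `2` from the Gaussian estimate plus room for replacing `Re u` by `Re w`.
  refine ⟨C * 64 * Real.exp (p * 3), by positivity, fun ρ hρ g hg w hw => ?_⟩
  have hq1 : 1 ≤ (1 + ρ) ^ 2 := one_le_pow₀ (by linarith)
  have hsub := ball_subset_wideStrip hq1 hw
  have hq0 : 0 < (1 + ρ) ^ 2 := by linarith
  refine (H g hg w (1 / (8 * (1 + ρ) ^ 2)) (by positivity)).trans ?_
  have hint : ∫⁻ u in Metric.ball w (1 / (8 * (1 + ρ) ^ 2)), ‖g u‖ₑ ^ p ≤
      ENNReal.ofReal (Real.exp (p * (3 + (ρ ^ 2 / 2 - (1 - w.re) * (1 + ρ) ^ 2 / 8)))) *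
        ∫⁻ u, ‖g u‖ₑ ^ p * bulkKernel p u ρ := by
    rw [← lintegral_const_mul' _ _ ENNReal.ofReal_ne_top,
      ← lintegral_indicator measurableSet_ball]
    refine lintegral_mono fun u => ?_
    by_cases hu : u ∈ Metric.ball w (1 / (8 * (1 + ρ) ^ 2))
    swap
    · rw [Set.indicator_of_notMem hu]
      exact zero_le
    rw [Set.indicator_of_mem hu, mul_left_comm, bulkKernel, if_pos (hsub hu),
      ← ENNReal.ofReal_mul (by positivity), ← Real.exp_add]
    refine le_mul_of_one_le_right zero_le ?_
    rw [ENNReal.one_le_ofReal, Real.one_le_exp_iff, ← sub_eq_add_neg, ← mul_sub]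
    refine mul_nonneg hp.le ?_
    have h1 := gaussian_exponent_le hρ (hsub hu)
    have hu' : ‖u - w‖ < 1 / (8 * (1 + ρ) ^ 2) := by simpa [dist_eq_norm] using hu
    have h2 := ((Complex.re_le_norm (u - w)).trans_lt hu').le
    rw [Complex.sub_re] at h2
    have h3 : (u.re - w.re) * (1 + ρ) ^ 2 ≤ 1 / (8 * (1 + ρ) ^ 2) * (1 + ρ) ^ 2 := by gcongr
    have h4 : 1 / (8 * (1 + ρ) ^ 2) * (1 + ρ) ^ 2 = 1 / 8 := by field_simp
    nlinarith
  refine (mul_le_mul_right hint _).trans (le_of_eq ?_)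
  rw [← mul_assoc, ← ENNReal.ofReal_mul (by positivity), mul_add, Real.exp_add]
  congr 2
  field_simp
  ring

theorem rpow_enorm_le_on_circle {p : ℝ} (hp : 0 < p) :
    ∃ C : ℝ, 0 < C ∧ ∀ g : ℂ → ℂ, Differentiable ℂ g → ∀ w : ℂ, ‖w‖ = 1 / 2 →
      ‖g w‖ₑ ^ p ≤ ENNReal.ofReal C * ∫⁻ u, ‖g u‖ₑ ^ p * annulusKernel u := by
  obtain ⟨C, hC, H⟩ := exists_rpow_enorm_le_lintegral_ball hp
  refine ⟨C / (1 / 4) ^ 2, by positivity, fun g hg w hw => ?_⟩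
  refine (H g hg w (1 / 4) (by norm_num)).trans (mul_le_mul_right ?_ _)
  rw [← lintegral_indicator measurableSet_ball]
  refine lintegral_mono fun u => ?_
  by_cases hu : u ∈ Metric.ball w (1 / 4)
  swap
  · rw [Set.indicator_of_notMem hu]
    exact zero_le
  have hu' : ‖u - w‖ < 1 / 4 := by simpa [dist_eq_norm] using hu
  have h1 := abs_lt.1 ((abs_norm_sub_norm_le u w).trans_lt hu')
  rw [Set.indicator_of_mem hu, annulusKernel, if_pos ⟨by linarith, by linarith⟩, mul_one]

theorem norm_le_of_rpow_enorm_le {p : ℝ} (hp : 0 < p) {x : ℂ} {b : ℝ} {A : ℝ≥0∞} (hA : A ≠ ∞)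
    (hb : 0 ≤ b) (h : ‖x‖ₑ ^ p ≤ ENNReal.ofReal b * A) : ‖x‖ ≤ (b * A.toReal) ^ (1 / p) := by
  rw [one_div, Real.le_rpow_inv_iff_of_pos (norm_nonneg _) (by positivity) hp]
  rw [← ofReal_norm, ENNReal.ofReal_rpow_of_nonneg (norm_nonneg _) hp.le,
    ← ENNReal.ofReal_toReal hA, ← ENNReal.ofReal_mul hb] at h
  exact (ENNReal.ofReal_le_ofReal_iff (by positivity)).1 h

/-- The `p`-th power form of a slice bound, in terms of integrals along the complex line. -/
theorem SliceBound.rpow_enorm_le {d : ℝ} {m : ℕ → ℝ} (h : SliceBound d m) {p : ℝ} (hp : 0 < p) :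
    ∃ C : ℝ, 0 < C ∧ ∀ ρ : ℝ, 0 ≤ ρ → ∀ g : ℂ → ℂ, Differentiable ℂ g →
      ‖∑' k, (m k : ℂ) * taylorCoeff k g‖ₑ ^ p ≤ ENNReal.ofReal C *
        (ENNReal.ofReal ((1 + ρ) ^ (2 * d * p + 4) * Real.exp (p * ρ ^ 2 / 2)) *
          (∫⁻ u, ‖g u‖ₑ ^ p * bulkKernel p u ρ) + ∫⁻ u, ‖g u‖ₑ ^ p * annulusKernel u) := by
  obtain ⟨K, hK, H⟩ := h
  obtain ⟨C₁, hC₁, H₁⟩ := rpow_enorm_le_on_strip hp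
  obtain ⟨C₂, hC₂, H₂⟩ := rpow_enorm_le_on_circle hp
  -- `K` may be `0`; `K + 1` keeps the constant positive, so that the right side is `∞` when one of
  -- the integrals is.
  refine ⟨(K + 1) ^ p * 2 ^ p * (C₁ + C₂), by positivity, fun ρ hρ g hg => ?_⟩
  set A := ∫⁻ u, ‖g u‖ₑ ^ p * bulkKernel p u ρ
  set A' := ∫⁻ u, ‖g u‖ₑ ^ p * annulusKernel u
  have hC0 : ENNReal.ofReal ((K + 1) ^ p * 2 ^ p * (C₁ + C₂)) ≠ 0 := by
    rw [Ne, ENNReal.ofReal_eq_zero, not_le]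
    positivity
  by_cases hA : A = ∞
  · rw [hA, ENNReal.mul_top, top_add, ENNReal.mul_top hC0]
    · exact le_top
    · rw [Ne, ENNReal.ofReal_eq_zero, not_le]
      positivity
  by_cases hA' : A' = ∞
  · rw [hA', add_top, ENNReal.mul_top hC0]
    exact le_top
  set a := A.toReal
  set a' := A'.toReal
  have ha : 0 ≤ a := ENNReal.toReal_nonneg
  have ha' : 0 ≤ a' := ENNReal.toReal_nonneg
  have hq1 : 1 ≤ (1 + ρ) ^ 2 := one_le_pow₀ (by linarith)
  set B := (C₁ * (1 + ρ) ^ 4 * a) ^ (1 / p) * Real.exp (ρ ^ 2 / 2) with hB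
  set B' := (C₂ * a') ^ (1 / p) with hB'
  have hBp : B ^ p = C₁ * (1 + ρ) ^ 4 * a * Real.exp (p * ρ ^ 2 / 2) := by
    rw [hB, Real.mul_rpow (by positivity) (by positivity), ← Real.rpow_mul (by positivity),
      one_div_mul_cancel hp.ne', Real.rpow_one, ← Real.exp_mul]
    ring_nf
  have hBp' : B' ^ p = C₂ * a' := by
    rw [hB', ← Real.rpow_mul (by positivity), one_div_mul_cancel hp.ne', Real.rpow_one]
  have key := H ((1 + ρ) ^ 2) hq1 g hg B B' (by positivity) (by positivity) ?_ ?_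
  · set S := ∑' k, (m k : ℂ) * taylorCoeff k g
    set X := ((1 + ρ) ^ 2) ^ d * B with hX
    have hX0 : 0 ≤ X := by positivity
    have hB0' : 0 ≤ B' := by positivity
    have hXp : X ^ p = (1 + ρ) ^ (2 * d * p + 4) * Real.exp (p * ρ ^ 2 / 2) * (C₁ * a) := by
      rw [hX, Real.mul_rpow (by positivity) (by positivity), hBp, ← Real.rpow_natCast,
        ← Real.rpow_mul (by positivity), ← Real.rpow_mul (by positivity),
        Real.rpow_add (by positivity)]
      norm_cast
      ring_nf
    have h1 : ‖S‖ ^ p ≤ (K + 1) ^ p * 2 ^ p * (X ^ p + B' ^ p) := by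
      have h2 : ‖S‖ ≤ (K + 1) * (2 * max X B') := by
        refine key.trans ?_
        have := le_max_left X B'
        have := le_max_right X B'
        gcongr <;> linarith
      calc ‖S‖ ^ p ≤ ((K + 1) * (2 * max X B')) ^ p := by gcongr
        _ = (K + 1) ^ p * 2 ^ p * max X B' ^ p := by
          rw [Real.mul_rpow (by positivity) (by positivity),
            Real.mul_rpow (by positivity) (by positivity)]
          ring
        _ ≤ _ := by
          gcongr
          have h3 : 0 ≤ X ^ p := by positivity
          have h4 : 0 ≤ B' ^ p := by positivity
          rcases max_choice X B' with h | h <;> rw [h] <;> linarith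
    have h2 : (K + 1) ^ p * 2 ^ p * (X ^ p + B' ^ p) ≤ (K + 1) ^ p * 2 ^ p * (C₁ + C₂) *
        ((1 + ρ) ^ (2 * d * p + 4) * Real.exp (p * ρ ^ 2 / 2) * a + a') := by
      rw [hXp, hBp', mul_assoc _ (C₁ + C₂)]
      gcongr
      have h3 : 0 ≤ (1 + ρ) ^ (2 * d * p + 4) * Real.exp (p * ρ ^ 2 / 2) * a := by positivity
      nlinarith
    rw [← ofReal_norm, ENNReal.ofReal_rpow_of_nonneg (norm_nonneg _) hp.le,
      ← ENNReal.ofReal_toReal hA, ← ENNReal.ofReal_toReal hA', ← ENNReal.ofReal_mul (by positivity),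
      ← ENNReal.ofReal_add (by positivity) ha', ← ENNReal.ofReal_mul (by positivity)]
    exact ENNReal.ofReal_le_ofReal (h1.trans h2)
  · intro w hw
    refine (norm_le_of_rpow_enorm_le hp hA (by positivity) (H₁ ρ hρ g hg w hw)).trans
      (le_of_eq ?_)
    rw [mul_right_comm, Real.mul_rpow (by positivity) (by positivity), ← Real.exp_mul, hB,
      mul_assoc _ (Real.exp _), ← Real.exp_add]
    congr 2
    field_simp
    ring
  · intro w hw
    exact norm_le_of_rpow_enorm_le hp hA' hC₂.le (H₂ g hg w hw)

theorem fockNorm_ofReal {n : ℕ} {p : ℝ} (hp : 0 < p) (α : ℝ) {f : Cn n → ℂ} (hf : Continuous f) :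
    fockNorm n (ENNReal.ofReal p) α f =
      (∫⁻ z, ‖f z‖ₑ ^ p * ENNReal.ofReal (Real.exp (-(p * ‖z‖ ^ 2 / 2)) * (1 + ‖z‖) ^ (-α))
        ∂dV n) ^ (1 / p) := by
  have hp0 : ENNReal.ofReal p ≠ 0 := by simpa using hp
  rw [fockNorm, if_neg ENNReal.ofReal_ne_top,
    eLpNorm_eq_lintegral_rpow_enorm_toReal hp0 ENNReal.ofReal_ne_top,
    ENNReal.toReal_ofReal hp.le, dVw]
  have hw : Continuous fun z : Cn n => (1 + ‖z‖) ^ α :=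
    (continuous_const.add continuous_norm).rpow_const fun z =>
      Or.inl (add_pos_of_pos_of_nonneg one_pos (norm_nonneg z)).ne'
  rw [lintegral_withDensity_eq_lintegral_mul _ (by fun_prop)]
  · congr 1
    refine lintegral_congr fun z => ?_
    rw [Pi.mul_apply, enorm_mul, ENNReal.mul_rpow_of_nonneg _ _ hp.le, mul_comm, mul_assoc]
    congr 1
    rw [← ofReal_norm, Complex.norm_real, Real.norm_of_nonneg (by positivity),
      ENNReal.ofReal_rpow_of_nonneg (by positivity) hp.le, ← ENNReal.ofReal_mul (by positivity),
      ← Real.exp_mul, Real.rpow_neg (by positivity), one_div]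
    ring_nf
  · refine Continuous.measurable ?_
    refine ENNReal.continuous_rpow_const.comp (continuous_enorm.comp (hf.mul ?_))
    fun_prop

theorem isBoundedFock_mulOp_of_bound {n : ℕ} {p : ℝ≥0∞} {α β : ℝ} {m : ℕ → ℝ} (hm : SubExp m)
    (h : ∃ C : ℝ≥0, ∀ f : Cn n → ℂ, Differentiable ℂ f → fockNorm n p α f < ∞ →
      fockNorm n p β (mulOp m f) ≤ C * fockNorm n p α f) :
    IsBoundedFock n p α β (mulOp m) := by
  obtain ⟨C, hC⟩ := h
  exact ⟨{
    toFun := fun f => ⟨mulOp m f, differentiable_mulOp hm f.2.1,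
      (hC f f.2.1 f.2.2).trans_lt (ENNReal.mul_lt_top ENNReal.coe_lt_top f.2.2)⟩
    map_add' := fun f g => Subtype.ext (mulOp_add hm f.2.1 g.2.1)
    map_smul' := fun c f => Subtype.ext (mulOp_smul m c f.2.1) },
    fun _ => rfl, C, fun f => hC f f.2.1 f.2.2⟩

theorem measurable_comp_of_uncurry {X : Type*} [MeasurableSpace X] {κ : ℂ → ℝ → ℝ≥0∞}
    (hκ : Measurable (Function.uncurry κ)) {u : X → ℂ} {v : X → ℝ} (hu : Measurable u)
    (hv : Measurable v) : Measurable fun x => κ (u x) (v x) :=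
  hκ.comp (hu.prodMk hv)

/-- The kernel on complex lines dominating a multiplier of order `d` from `F^p_α`. -/
def lineKernel (p α d : ℝ) (w : ℂ) (ρ : ℝ) : ℝ≥0∞ :=
  ENNReal.ofReal ((1 + ρ) ^ (4 - α)) * bulkKernel p w ρ +
    ENNReal.ofReal (Real.exp (-(p * ρ ^ 2 / 2)) * (1 + ρ) ^ (-(α + 2 * d * p))) * annulusKernel w

theorem measurable_lineKernel (p α d : ℝ) : Measurable (Function.uncurry (lineKernel p α d)) :=
  Measurable.add (Measurable.mul (by fun_prop) (measurable_bulkKernel p))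
    (Measurable.mul (by fun_prop) (measurable_annulusKernel.comp measurable_fst))

theorem lineKernel_zero (p α d ρ : ℝ) : lineKernel p α d 0 ρ = 0 := by
  rw [lineKernel, bulkKernel, if_neg, annulusKernel, if_neg]
  · simp
  · simp
  · rintro ⟨h1, -⟩
    norm_num at h1

theorem lintegral_mul_add_mul {G₁ G₂ : ℂ → ℝ≥0∞} (c₁ c₂ : ℝ≥0∞) (h₁ : Measurable G₁)
    (h₂ : Measurable G₂) :
    ∫⁻ w, (c₁ * G₁ w + c₂ * G₂ w) = c₁ * (∫⁻ w, G₁ w) + c₂ * ∫⁻ w, G₂ w := by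
  rw [lintegral_add_left (h₁.const_mul c₁), lintegral_const_mul c₁ h₁, lintegral_const_mul c₂ h₂]

theorem lintegral_lineKernel_le {p : ℝ} (hp : 0 < p) (n : ℕ) (α d : ℝ) :
    ∃ C : ℝ, 0 ≤ C ∧ ∀ r : ℝ, 0 ≤ r →
      ∫⁻ w : ℂ, ENNReal.ofReal ((‖w‖ ^ (2 * n))⁻¹) * lineKernel p α d w (r / ‖w‖) ≤
        ENNReal.ofReal C * ENNReal.ofReal (Real.exp (-(p * r ^ 2 / 2)) * (1 + r) ^ (-α)) := by
  obtain ⟨C₁, hC₁, H₁⟩ := lintegral_bulkKernel_le hp n α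
  obtain ⟨C₂, hC₂, H₂⟩ := lintegral_annulusKernel_le hp n α (-(α + 2 * d * p))
  refine ⟨C₁ + C₂, by positivity, fun r hr => ?_⟩
  have hb : Measurable fun w : ℂ => bulkKernel p w (r / ‖w‖) :=
    measurable_comp_of_uncurry (measurable_bulkKernel p) measurable_id (by fun_prop)
  have hm : Measurable fun w : ℂ => ENNReal.ofReal ((‖w‖ ^ (2 * n))⁻¹) *
      (ENNReal.ofReal ((1 + r / ‖w‖) ^ (4 - α)) * bulkKernel p w (r / ‖w‖)) := by
    fun_prop
  rw [ENNReal.ofReal_add hC₁ hC₂, add_mul]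
  refine le_trans (le_of_eq ?_) (add_le_add (H₁ r hr) (H₂ r hr))
  rw [← lintegral_add_left hm]
  refine lintegral_congr fun w => ?_
  rw [lineKernel, mul_add]

theorem lintegral_mul_lineKernel (p α d ρ : ℝ) {G : ℂ → ℝ≥0∞} (hG : Measurable G) :
    ∫⁻ w, G w * lineKernel p α d w ρ =
      ENNReal.ofReal ((1 + ρ) ^ (4 - α)) * (∫⁻ w, G w * bulkKernel p w ρ) +
        ENNReal.ofReal (Real.exp (-(p * ρ ^ 2 / 2)) * (1 + ρ) ^ (-(α + 2 * d * p))) *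
          ∫⁻ w, G w * annulusKernel w := by
  have hb : Measurable fun w : ℂ => bulkKernel p w ρ :=
    measurable_comp_of_uncurry (measurable_bulkKernel p) measurable_id measurable_const
  have ha := measurable_annulusKernel
  have h1 : Measurable fun w => G w * bulkKernel p w ρ := by fun_prop
  have h2 : Measurable fun w => G w * annulusKernel w := by fun_prop
  rw [← lintegral_mul_add_mul _ _ h1 h2]
  refine lintegral_congr fun w => ?_
  rw [lineKernel, mul_add, mul_left_comm, mul_left_comm (G w)]

/-- The target weight turns the power `2dp + 4` into `4 - α`. The order `d` thus disappears from the
bulk term, leaving the power from which `lintegral_bulkKernel_le` recovers the source weight. -/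
theorem SliceBound.rpow_enorm_mul_weight_le {d : ℝ} {m : ℕ → ℝ} (h : SliceBound d m) {p : ℝ}
    (hp : 0 < p) (α : ℝ) : ∃ C : ℝ, 0 < C ∧ ∀ ρ : ℝ, 0 ≤ ρ → ∀ g : ℂ → ℂ, Differentiable ℂ g →
      ‖∑' k, (m k : ℂ) * taylorCoeff k g‖ₑ ^ p *
        ENNReal.ofReal (Real.exp (-(p * ρ ^ 2 / 2)) * (1 + ρ) ^ (-(α + 2 * d * p))) ≤
      ENNReal.ofReal C * ∫⁻ w, ‖g w‖ₑ ^ p * lineKernel p α d w ρ := by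
  obtain ⟨C, hC, H⟩ := h.rpow_enorm_le hp
  refine ⟨C, hC, fun ρ hρ g hg => ?_⟩
  have hG : Measurable fun w : ℂ => ‖g w‖ₑ ^ p :=
    (ENNReal.continuous_rpow_const.comp (continuous_enorm.comp hg.continuous)).measurable
  rw [lintegral_mul_lineKernel p α d ρ hG]
  refine (mul_le_mul_left (H ρ hρ g hg) _).trans (le_of_eq ?_)
  have e : ENNReal.ofReal ((1 + ρ) ^ (4 - α)) =
      ENNReal.ofReal ((1 + ρ) ^ (2 * d * p + 4) * Real.exp (p * ρ ^ 2 / 2)) *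
        ENNReal.ofReal (Real.exp (-(p * ρ ^ 2 / 2)) * (1 + ρ) ^ (-(α + 2 * d * p))) := by
    rw [← ENNReal.ofReal_mul (by positivity),
      show 4 - α = (2 * d * p + 4) + -(α + 2 * d * p) by ring,
      Real.rpow_add (by positivity) (2 * d * p + 4), Real.exp_neg]
    congr 1
    field_simp
  rw [e]
  ring

theorem SliceBound.isBoundedFock_ofReal {d : ℝ} {m : ℕ → ℝ} (h : SliceBound d m) (hm : SubExp m)
    (n : ℕ) (α : ℝ) {p : ℝ} (hp : 0 < p) :
    IsBoundedFock n (ENNReal.ofReal p) α (α + 2 * d * p) (mulOp m) := by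
  refine isBoundedFock_mulOp_of_bound hm ?_
  obtain ⟨C, hC, H⟩ := h.rpow_enorm_mul_weight_le hp α
  obtain ⟨C₁, hC₁, H₁⟩ := lintegral_lineKernel_le hp n α d
  have hD0 : 0 ≤ C * C₁ := by positivity
  refine ⟨((C * C₁) ^ (1 / p)).toNNReal, fun f hf _ => ?_⟩
  have hF : Measurable fun z : Cn n => ‖f z‖ₑ ^ p :=
    (ENNReal.continuous_rpow_const.comp (continuous_enorm.comp hf.continuous)).measurable
  have key := lintegral_lintegral_slice_le
    (ω := fun r => ENNReal.ofReal (Real.exp (-(p * r ^ 2 / 2)) * (1 + r) ^ (-α)))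
    (measurable_lineKernel p α d) (lineKernel_zero p α d) ENNReal.ofReal_ne_top H₁ hF
  have hC' : ((((C * C₁) ^ (1 / p)).toNNReal : ℝ≥0) : ℝ≥0∞) =
      ENNReal.ofReal (C * C₁) ^ (1 / p) :=
    (ENNReal.ofReal_rpow_of_nonneg hD0 (by positivity)).symm
  rw [fockNorm_ofReal hp _ (differentiable_mulOp hm hf).continuous,
    fockNorm_ofReal hp _ hf.continuous, hC', ← ENNReal.mul_rpow_of_nonneg _ _ (by positivity)]
  refine ENNReal.rpow_le_rpow ?_ (by positivity)
  rw [ENNReal.ofReal_mul hC.le, mul_assoc (ENNReal.ofReal C)]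
  refine le_trans ?_ (mul_le_mul_right key _)
  rw [← lintegral_const_mul' _ _ ENNReal.ofReal_ne_top]
  exact lintegral_mono fun z => H ‖z‖ (norm_nonneg z) _ (differentiable_slice hf z)

/-! ### The case `p = ∞` -/

/-- For a continuous function the essential supremum bounds every value, since `dV n` charges
nonempty open sets. -/
theorem norm_le_of_fockNorm_top_lt {n : ℕ} {α : ℝ} {f : Cn n → ℂ} (hf : Continuous f)
    (h : fockNorm n ∞ α f < ∞) (z : Cn n) :
    ‖f z‖ ≤ (fockNorm n ∞ α f).toReal * Real.exp (‖z‖ ^ 2 / 2) * (1 + ‖z‖) ^ α := by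
  set N := fockNorm n ∞ α f with hN
  have hw : Continuous fun z : Cn n => (1 + ‖z‖) ^ α :=
    (continuous_const.add continuous_norm).rpow_const fun z =>
      Or.inl (add_pos_of_pos_of_nonneg one_pos (norm_nonneg z)).ne'
  set G : Cn n → ℂ := fun z => f z * ((Real.exp (-‖z‖ ^ 2 / 2) / (1 + ‖z‖) ^ α : ℝ) : ℂ) with hG
  have hGc : Continuous G := hf.mul (Complex.continuous_ofReal.comp
    (Continuous.div (by fun_prop) hw fun z => by positivity))
  have hae : ∀ᵐ z ∂dV n, ‖G z‖ₑ ≤ N := by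
    have := ae_le_eLpNormEssSup (f := G) (μ := dV n)
    rw [hN, fockNorm, if_pos rfl, eLpNorm_exponent_top]
    exact this
  have hall : ‖G z‖ₑ ≤ N := by
    have hopen : IsOpen {z | ¬‖G z‖ₑ ≤ N} := by
      simp only [not_le]
      exact isOpen_lt continuous_const (continuous_enorm.comp hGc)
    have h0 := (hopen.measure_eq_zero_iff (dV n)).1 hae
    by_contra hcon
    exact (Set.eq_empty_iff_forall_notMem.1 h0 z) hcon
  rw [← ofReal_norm, ENNReal.ofReal_le_iff_le_toReal h.ne, norm_mul, Complex.norm_real,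
    Real.norm_of_nonneg (by positivity), ← mul_div_assoc, div_le_iff₀ (by positivity)] at hall
  have e : Real.exp (-‖z‖ ^ 2 / 2) * Real.exp (‖z‖ ^ 2 / 2) = 1 := by
    rw [← Real.exp_add, neg_div, neg_add_cancel, Real.exp_zero]
  calc ‖f z‖ = ‖f z‖ * Real.exp (-‖z‖ ^ 2 / 2) * Real.exp (‖z‖ ^ 2 / 2) := by
        rw [mul_assoc, e, mul_one]
    _ ≤ N.toReal * (1 + ‖z‖) ^ α * Real.exp (‖z‖ ^ 2 / 2) := by gcongr
    _ = _ := by ring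

theorem fockNorm_top_le {n : ℕ} {α M : ℝ} {f : Cn n → ℂ}
    (h : ∀ z, ‖f z‖ ≤ M * Real.exp (‖z‖ ^ 2 / 2) * (1 + ‖z‖) ^ α) :
    fockNorm n ∞ α f ≤ ENNReal.ofReal M := by
  rw [fockNorm, if_pos rfl, eLpNorm_exponent_top]
  refine eLpNormEssSup_le_of_ae_bound (Filter.Eventually.of_forall fun z => ?_)
  rw [norm_mul, Complex.norm_real, Real.norm_of_nonneg (by positivity), ← mul_div_assoc,
    div_le_iff₀ (by positivity)]
  have e : Real.exp (‖z‖ ^ 2 / 2) * Real.exp (-‖z‖ ^ 2 / 2) = 1 := by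
    rw [← Real.exp_add, neg_div, add_neg_cancel, Real.exp_zero]
  calc _ ≤ M * Real.exp (‖z‖ ^ 2 / 2) * (1 + ‖z‖) ^ α * Real.exp (-‖z‖ ^ 2 / 2) := by
        gcongr
        exact h z
    _ = M * (1 + ‖z‖) ^ α * (Real.exp (‖z‖ ^ 2 / 2) * Real.exp (-‖z‖ ^ 2 / 2)) := by ring
    _ = _ := by rw [e, mul_one]

theorem one_add_mul_rpow_le {r u : ℝ} (hr : 0 ≤ r) (h1 : 1 / 8 ≤ u) (h2 : u ≤ 8) (γ : ℝ) :
    (1 + u * r) ^ γ ≤ 8 ^ |γ| * (1 + r) ^ γ := by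
  have hu : 0 < u := by linarith
  have h := one_add_div_rpow_le (u := u⁻¹) hr
    (by rw [le_inv_comm₀ (by norm_num) hu]; linarith)
    (by rw [inv_le_comm₀ hu (by norm_num)]; linarith) γ
  rwa [div_inv_eq_mul, mul_comm r u] at h

/-- On the strip the growth of `f` has the shape required with `B` of size `e^{ρ²/2}(1+ρ)^α`. On
`|w| = 1/2` it is only `e^{ρ²/8}(1+ρ)^α`. -/
theorem SliceBound.isBoundedFock_top {d : ℝ} {m : ℕ → ℝ} (h : SliceBound d m) (hm : SubExp m)
    (n : ℕ) (α : ℝ) : IsBoundedFock n ∞ α (α + 2 * d) (mulOp m) := by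
  refine isBoundedFock_mulOp_of_bound hm ?_
  obtain ⟨K, hK, H⟩ := h
  -- Here `3/8 = 1/2 - 1/8` is the Gaussian gap between the point `1` and the circle `|w| = 1/2`; it
  -- pays for `(1+ρ)^(-2d)` when `d < 0`.
  obtain ⟨C, hC, hCr⟩ := one_add_rpow_le_exp (-(2 * d)) (show (0 : ℝ) < 3 / 8 by norm_num)
  have hD0 : 0 ≤ K * (8 ^ |α| * (Real.exp 3 + C)) := by positivity
  refine ⟨(K * (8 ^ |α| * (Real.exp 3 + C))).toNNReal, fun f hf hfin => ?_⟩
  set N := (fockNorm n ∞ α f).toReal with hN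
  have hN0 : 0 ≤ N := ENNReal.toReal_nonneg
  have hpt := norm_le_of_fockNorm_top_lt hf.continuous hfin
  rw [← hN] at hpt
  have key : ∀ z, ‖mulOp m f z‖ ≤ K * (8 ^ |α| * (Real.exp 3 + C)) * N *
      Real.exp (‖z‖ ^ 2 / 2) * (1 + ‖z‖) ^ (α + 2 * d) := by
    intro z
    set ρ := ‖z‖ with hρdef
    have hρ : 0 ≤ ρ := norm_nonneg z
    have hq1 : 1 ≤ (1 + ρ) ^ 2 := one_le_pow₀ (by linarith)
    have h1 := H ((1 + ρ) ^ 2) hq1 _ (differentiable_slice hf z)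
      (N * (Real.exp 3 * Real.exp (ρ ^ 2 / 2)) * (8 ^ |α| * (1 + ρ) ^ α))
      (N * Real.exp (ρ ^ 2 / 8) * (8 ^ |α| * (1 + ρ) ^ α)) (by positivity) (by positivity) ?_ ?_
    · refine h1.trans ?_
      have e1 : ((1 + ρ) ^ 2) ^ d * (1 + ρ) ^ α = (1 + ρ) ^ (α + 2 * d) := by
        rw [← Real.rpow_natCast, ← Real.rpow_mul (by positivity), ← Real.rpow_add (by positivity)]
        congr 1
        push_cast
        ring
      have e2 : Real.exp (ρ ^ 2 / 8) * (1 + ρ) ^ α ≤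
          C * Real.exp (ρ ^ 2 / 2) * (1 + ρ) ^ (α + 2 * d) := by
        have e3 : (1 + ρ) ^ α = (1 + ρ) ^ (-(2 * d)) * (1 + ρ) ^ (α + 2 * d) := by
          rw [← Real.rpow_add (by positivity)]
          ring_nf
        have e4 : Real.exp (ρ ^ 2 / 2) = Real.exp (ρ ^ 2 / 8) * Real.exp (3 / 8 * ρ ^ 2) := by
          rw [← Real.exp_add]
          ring_nf
        rw [e3, e4]
        calc _ ≤ Real.exp (ρ ^ 2 / 8) * (C * Real.exp (3 / 8 * ρ ^ 2) *
              (1 + ρ) ^ (α + 2 * d)) := by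
              gcongr
              exact hCr ρ hρ
          _ = _ := by ring
      calc _ = K * (8 ^ |α| * N * (Real.exp 3 * Real.exp (ρ ^ 2 / 2) *
            (((1 + ρ) ^ 2) ^ d * (1 + ρ) ^ α) + Real.exp (ρ ^ 2 / 8) * (1 + ρ) ^ α)) := by ring
        _ ≤ K * (8 ^ |α| * N * (Real.exp 3 * Real.exp (ρ ^ 2 / 2) * (1 + ρ) ^ (α + 2 * d) +
            C * Real.exp (ρ ^ 2 / 2) * (1 + ρ) ^ (α + 2 * d))) := by
            rw [e1]
            gcongr
        _ = _ := by ring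
    · intro w hw
      have hδ : 0 < 1 / (8 * (1 + ρ) ^ 2) := by positivity
      have hw' := ball_subset_wideStrip hq1 hw (Metric.mem_ball_self hδ)
      obtain ⟨hn1, hn2⟩ := norm_mem_of_mem_wideStrip hq1 hw'
      have h2 := gaussian_exponent_le hρ hw'
      have h3 : (w.re - 1) * (1 + ρ) ^ 2 ≤ 1 / 8 := by
        have h4 : 1 / (8 * (1 + ρ) ^ 2) * (1 + ρ) ^ 2 = 1 / 8 := by field_simp
        rw [← h4]
        gcongr
        linarith [hw.2.1]
      refine (hpt (w • z)).trans ?_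
      rw [norm_smul, ← hρdef]
      have h5 := one_add_mul_rpow_le hρ hn1.le (by linarith) α
      have h6 : Real.exp ((‖w‖ * ρ) ^ 2 / 2) ≤ Real.exp 3 * Real.exp (ρ ^ 2 / 2) *
          Real.exp (-((1 - w.re) * (1 + ρ) ^ 2 / 8)) := by
        rw [← Real.exp_add, ← Real.exp_add, Real.exp_le_exp]
        nlinarith
      calc _ ≤ N * (Real.exp 3 * Real.exp (ρ ^ 2 / 2) *
            Real.exp (-((1 - w.re) * (1 + ρ) ^ 2 / 8))) * (8 ^ |α| * (1 + ρ) ^ α) := by gcongr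
        _ = _ := by ring
    · intro w hw
      refine (hpt (w • z)).trans ?_
      rw [norm_smul, ← hρdef]
      have h5 := one_add_mul_rpow_le hρ (by linarith : 1 / 8 ≤ ‖w‖) (by linarith) α
      rw [show (‖w‖ * ρ) ^ 2 / 2 = ρ ^ 2 / 8 by rw [hw]; ring]
      gcongr
  refine (fockNorm_top_le key).trans (le_of_eq ?_)
  rw [ENNReal.ofReal_mul hD0, hN, ENNReal.ofReal_toReal hfin.ne]
  rfl

/-! ### Composition and Gamma quotients -/

theorem IsBoundedFock.comp_mulOp {n : ℕ} {p : ℝ≥0∞} {α β γ : ℝ} {m m' : ℕ → ℝ} (hm : SubExp m)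
    (h : IsBoundedFock n p α β (mulOp m)) (h' : IsBoundedFock n p β γ (mulOp m')) :
    IsBoundedFock n p α γ (mulOp fun k => m' k * m k) := by
  obtain ⟨L, hL, C, hC⟩ := h
  obtain ⟨L', hL', C', hC'⟩ := h'
  refine ⟨L' ∘ₗ L, fun f => ?_, C' * C, fun f => ?_⟩
  · rw [LinearMap.comp_apply, hL', hL, mulOp_mulOp m' hm f.2.1]
  · rw [LinearMap.comp_apply, ENNReal.coe_mul, mul_assoc]
    exact (hC' (L f)).trans (mul_le_mul_right (hC f) _)

/-- The multiplier operator of `m` shifts the weight parameter by order `d`, for all exponents. -/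
structure HasOrder (n : ℕ) (d : ℝ) (m : ℕ → ℝ) : Prop where
  subExp : SubExp m
  ofReal : ∀ (α p : ℝ), 0 < p → IsBoundedFock n (ENNReal.ofReal p) α (α + 2 * d * p) (mulOp m)
  top : ∀ α : ℝ, IsBoundedFock n ∞ α (α + 2 * d) (mulOp m)

theorem SliceBound.hasOrder {d : ℝ} {m : ℕ → ℝ} (h : SliceBound d m) (hm : SubExp m) (n : ℕ) :
    HasOrder n d m :=
  ⟨hm, fun α _ hp => h.isBoundedFock_ofReal hm n α hp, h.isBoundedFock_top hm n⟩

theorem HasOrder.mul {n : ℕ} {d d' : ℝ} {m m' : ℕ → ℝ} (h : HasOrder n d m)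
    (h' : HasOrder n d' m') : HasOrder n (d + d') fun k => m' k * m k := by
  refine ⟨h'.subExp.mul h.subExp, fun α p hp => ?_, fun α => ?_⟩
  · have := (h.ofReal α p hp).comp_mulOp h.subExp (h'.ofReal _ p hp)
    rwa [show α + 2 * d * p + 2 * d' * p = α + 2 * (d + d') * p by ring] at this
  · have := (h.top α).comp_mulOp h.subExp (h'.top _)
    rwa [show α + 2 * d + 2 * d' = α + 2 * (d + d') by ring] at this

theorem HasOrder.prod_mul {n : ℕ} {d : ℝ} {m : ℕ → ℝ} (h : HasOrder n d m) (c : ℝ) (N : ℕ) :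
    HasOrder n (d + N) fun k => (∏ j ∈ Finset.range N, (c + j + k)) * m k := by
  induction N with
  | zero => simpa using h
  | succ N ih =>
    have h1 := ih.mul ((sliceBound_natCast_add (c + N)).hasOrder (subExp_natCast_add _) n)
    rw [show d + N + 1 = d + ((N + 1 : ℕ) : ℝ) by push_cast; ring] at h1
    convert h1 using 2 with k
    rw [Finset.prod_range_succ]
    ring

theorem prod_add_mul_gamma {x : ℝ} (hx : 0 < x) (N : ℕ) :
    (∏ j ∈ Finset.range N, (x + j)) * Real.Gamma x = Real.Gamma (x + N) := by
  induction N with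
  | zero => simp
  | succ N ih =>
    rw [Finset.prod_range_succ, mul_right_comm, ih, Nat.cast_succ, ← add_assoc,
      Real.Gamma_add_one (by positivity), mul_comm]

theorem exists_forall_ge_of_abs_lt (s : ℝ) : ∃ K : ℕ, ∀ k : ℕ, K ≤ k → 0 ≤ s ∨ |s| < k := by
  obtain ⟨K, hK⟩ := exists_nat_gt |s|
  exact ⟨K, fun k hk => Or.inr (hK.trans_le (by exact_mod_cast hk))⟩

/-- Factor `Γ(n+s+k)/Γ(n+k)` as `∏_{j<N} (n+j+k)` times `Γ(n+s+k)/Γ(n+N+k)`, of orders `N` and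
`-(N-s)`. Taking `N ≥ s + 1` makes `σ = N - s ≥ 1`, so that the Beta weight stays bounded at `t =
1`. -/
theorem hasOrder_derivCoeff {n : ℕ} (hn : 1 ≤ n) (s : ℝ) : HasOrder n s (derivCoeff n s) := by
  have hn' : (1 : ℝ) ≤ n := by exact_mod_cast hn
  obtain ⟨N, hN⟩ := exists_nat_ge (s + 1)
  obtain ⟨h1, h2⟩ := sliceBound_gammaRatio (a := n + s) (σ := N - s) (by linarith)
    (fun k : ℕ => 0 ≤ s ∨ |s| < k) (exists_forall_ge_of_abs_lt s)
  have h3 := (h2.hasOrder h1 n).prod_mul n N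
  rw [show -(N - s) + N = s by ring] at h3
  convert h3 using 2 with k
  rw [derivCoeff]
  split_ifs with hk
  · have hk0 : (0 : ℝ) ≤ k := Nat.cast_nonneg k
    have e : ∏ j ∈ Finset.range N, ((n : ℝ) + j + k) = ∏ j ∈ Finset.range N, ((n : ℝ) + k + j) :=
      Finset.prod_congr rfl fun j _ => by ring
    have hx : 0 < (n : ℝ) + k := by linarith
    have h4 := prod_add_mul_gamma hx N
    have h5 := (Real.Gamma_pos_of_pos hx).ne'
    have h6 := (Real.Gamma_pos_of_pos (show 0 < (n : ℝ) + k + N by positivity)).ne'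
    rw [e, show (n : ℝ) + s + (N - s) + k = n + k + N by ring, eq_div_of_mul_eq h5 h4]
    field_simp
  · simp

theorem hasOrder_integCoeff {n : ℕ} (hn : 1 ≤ n) (s : ℝ) :
    HasOrder n s (integCoeff n (-s)) := by
  have hn' : (1 : ℝ) ≤ n := by exact_mod_cast hn
  obtain ⟨N, hN⟩ := exists_nat_ge (s + 1)
  obtain ⟨h1, h2⟩ := sliceBound_gammaRatio (a := n) (σ := N - s) (by linarith)
    (fun k : ℕ => 0 ≤ -s ∨ |(-s)| < k) (exists_forall_ge_of_abs_lt (-s))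
  have h3 := (h2.hasOrder h1 n).prod_mul (n - s) N
  rw [show -(N - s) + N = s by ring] at h3
  convert h3 using 2 with k
  rw [integCoeff]
  split_ifs with hk
  · have hk0 : (0 : ℝ) ≤ k := Nat.cast_nonneg k
    have e : ∏ j ∈ Finset.range N, ((n : ℝ) - s + j + k) =
        ∏ j ∈ Finset.range N, ((n : ℝ) - s + k + j) := Finset.prod_congr rfl fun j _ => by ring
    -- Dropping the indices `k ≤ |s|` when `-s < 0` is what keeps the Gamma argument positive.
    have hx : 0 < (n : ℝ) - s + k := by
      rcases hk with h | h
      · linarith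
      · rw [abs_neg] at h
        linarith [le_abs_self s]
    have h4 := prod_add_mul_gamma hx N
    have h5 := (Real.Gamma_pos_of_pos hx).ne'
    have h6 := (Real.Gamma_pos_of_pos (show 0 < (n : ℝ) - s + k + N by positivity)).ne'
    rw [e, show (n : ℝ) + (N - s) + k = n - s + k + N by ring,
      show (n : ℝ) + -s + k = n - s + k by ring, eq_div_of_mul_eq h5 h4]
    field_simp
  · simp

end FockSobolev

end

theorem theorem3p13 (n : ℕ) (hn : 1 ≤ n) (s α : ℝ) :
    (∀ p : ℝ, 0 < p →
      FockSobolev.IsBoundedFock n (ENNReal.ofReal p) α (α + 2 * s * p)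
          (FockSobolev.fracDeriv s) ∧
        FockSobolev.IsBoundedFock n (ENNReal.ofReal p) α (α + 2 * s * p)
          (FockSobolev.fracInteg (-s))) ∧
      FockSobolev.IsBoundedFock n ∞ α (α + 2 * s) (FockSobolev.fracDeriv s) ∧
        FockSobolev.IsBoundedFock n ∞ α (α + 2 * s) (FockSobolev.fracInteg (-s)) := by
  have hD := FockSobolev.hasOrder_derivCoeff hn s
  have hI := FockSobolev.hasOrder_integCoeff hn s
  -- `fracDeriv s` and `fracInteg (-s)` are by definition `mulOp` of their coefficient sequences.
  exact ⟨fun p hp => ⟨hD.ofReal α p hp, hI.ofReal α p hp⟩, hD.top α, hI.top α⟩
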